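/- Let $N\ge 1$ be an integer, let $m\ge 0$, $p>1$ and $R>0$ be real numbers, and put $\xi(t)=\frac{t^{m+1}}{m+1}$ and $D=(m+1)(N-1)-m$. Let $p_{tr}(N,m)=1+\frac{2}{D}$ if $D>0$ (that is, $N\ge 2$) and $p_{tr}(N,m)=+\infty$ if $D\le 0$ (that is, $N=1$). Let $f,g\in C_0^\infty(\mathbb R^N)$ be non-negative functions, supported in the closed ball of radius $R$ about the origin, which are not both identically zero. For $\varepsilon>0$ consider $$u_{tt}-t^{2m}\Delta u=|u_t|^p,\qquad u(x,0)=\varepsilon f(x),\quad u_t(x,0)=\varepsilon g(x). \qquad (1)$$ For $0<T\le\infty$, an energy solution of (1) on $[0,T)$ is a function $u\in C([0,T),H^1(\mathbb R^N))\cap C^1([0,T),L^2(\mathbb R^N))$ with $u_t\in L^p_{loc}((0,T)\times\mathbb R^N)$ and $u(0)=\varepsilon f$, $u_t(0)=\varepsilon g$, such that for all $\Phi\in C_0^\infty(\mathbb R^N\times[0,T))$ and all $t\in[0,T)$ the integral on the right below converges absolutely and $$\int_{\mathbb R^N}u_t(x,t)\Phi(x,t)\,dx-\int_{\mathbb R^N}u_t(x,0)\Phi(x,0)\,dx-\int_0^t\!\int_{\mathbb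 R^N}u_t\Phi_t\,dx\,ds+\int_0^t s^{2m}\!\int_{\mathbb R^N}\nabla u\cdot\nabla\Phi\,dx\,ds=\int_0^t\!\int_{\mathbb R^N}|u_t|^p\Phi\,dx\,ds .$$ Then there are constants $\varepsilon_0>0$ and $C>0$, depending only on $f,g,N,R,p,m$, such that for every $0<\varepsilon\le\varepsilon_0$, every $T_\varepsilon\in(0,\infty]$ and every energy solution $u$ of (1) on $[0,T_\varepsilon)$ with $\operatorname{supp}u\subset\{(x,t):|x|\le\xi(t)+R\}$, one has $$T_\varepsilon\le C\,\varepsilon^{-\frac{2(p-1)}{2-((m+1)(N-1)-m)(p-1)}}\quad\text{if }1<p<p_{tr}(N,m),\qquad T_\varepsilon\le\exp\!\big(C\varepsilon^{-(p-1)}\big)\quad\text{if }p=p_{tr}(N,m).$$ -/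

import Mathlib

open MeasureTheory Set
open scoped ContDiff

noncomputable section

/-- The space `L²(ℝᴺ; F)`. -/
abbrev L2 (N : ℕ) (F : Type) [NormedAddCommGroup F] : Type :=
  Lp F 2 (volume : Measure (EuclideanSpace ℝ (Fin N)))

/-- The time interval `[0, T)`, where `T` may be `+∞`. -/
def timeInterval (T : EReal) : Set ℝ := {t : ℝ | 0 ≤ t ∧ (t : EReal) < T}

/-- `ξ(t) = t^(m+1) / (m+1)`. -/
def xi (m t : ℝ) : ℝ := t ^ (m + 1) / (m + 1)

/-- `w` is the weak gradient of `u`; thus `u ∈ H¹(ℝᴺ)` iff such a `w ∈ L²(ℝᴺ; ℝᴺ)` exists, and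
`‖u‖²_{H¹} = ‖u‖² + ‖w‖²`. -/
def IsWeakGradient {N : ℕ} (u : L2 N ℝ) (w : L2 N (EuclideanSpace ℝ (Fin N))) : Prop :=
  ∀ φ : EuclideanSpace ℝ (Fin N) → ℝ, ContDiff ℝ ∞ φ → HasCompactSupport φ →
    ∀ e : EuclideanSpace ℝ (Fin N),
      ∫ x, u x * fderiv ℝ φ x e = - ∫ x, inner ℝ (w x) e * φ x

/-- Test functions of class `C₀^∞(ℝᴺ × [0, T))`, as restrictions to `t ≥ 0` of smooth functions
with compact support in `ℝᴺ × (-∞, T)`: they need not vanish at `t = 0`. -/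
structure IsTestFunction {N : ℕ} (T : EReal) (Φ : EuclideanSpace ℝ (Fin N) × ℝ → ℝ) : Prop where
  smooth : ContDiff ℝ ∞ Φ
  compact_support : HasCompactSupport Φ
  support_lt : ∀ z ∈ tsupport Φ, (z.2 : EReal) < T

/-- `u`, with time derivative `v` and spatial weak gradient `w`, is an energy solution on `[0, T)` of
`u_tt - t^(2m) Δu = |u_t|^p`, `u(0) = ε f`, `u_t(0) = ε g`. -/
structure IsEnergySolutionWith (N : ℕ) (m p ε : ℝ) (f g : EuclideanSpace ℝ (Fin N) → ℝ)
    (T : EReal) (u v : ℝ → L2 N ℝ) (w : ℝ → L2 N (EuclideanSpace ℝ (Fin N))) : Prop where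
  /-- `w(t) = ∇u(t)`; with the next two fields, `u ∈ C([0, T), H¹)`. -/
  weak_gradient : ∀ t ∈ timeInterval T, IsWeakGradient (u t) (w t)
  continuous_u : ContinuousOn u (timeInterval T)
  continuous_w : ContinuousOn w (timeInterval T)
  /-- `v = u_t`; with the next field, `u ∈ C¹([0, T), L²)`. -/
  deriv_u : ∀ t ∈ timeInterval T, HasDerivWithinAt u (v t) (timeInterval T) t
  continuous_v : ContinuousOn v (timeInterval T)
  /-- `u_t ∈ L^p_loc((0, T) × ℝᴺ)`. -/
  locally_Lp : ∀ a b r : ℝ, 0 < a → (b : EReal) < T →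
    ∫⁻ s in Icc a b, ∫⁻ x in Metric.closedBall 0 r, ENNReal.ofReal (|v s x| ^ p) < ⊤
  initial_u : ∀ᵐ x, u 0 x = ε * f x
  initial_v : ∀ᵐ x, v 0 x = ε * g x
  /-- The nonlinear integral in the weak formulation converges absolutely: for almost every `s` the
  inner integral does, and so does the outer one. -/
  nonlinear_integrable : ∀ Φ : EuclideanSpace ℝ (Fin N) × ℝ → ℝ, IsTestFunction T Φ →
    ∀ t ∈ timeInterval T,
      (∀ᵐ s ∂(volume.restrict (Ioc 0 t)), Integrable (fun x => |v s x| ^ p * |Φ (x, s)|)) ∧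
      IntervalIntegrable (fun s => ∫ x, |v s x| ^ p * |Φ (x, s)|) volume 0 t
  /-- The weak formulation. -/
  weak_form : ∀ Φ : EuclideanSpace ℝ (Fin N) × ℝ → ℝ, IsTestFunction T Φ →
    ∀ t ∈ timeInterval T,
      (∫ x, v t x * Φ (x, t)) - (∫ x, v 0 x * Φ (x, 0))
        - (∫ s in (0 : ℝ)..t, ∫ x, v s x * deriv (fun τ => Φ (x, τ)) s)
        + (∫ s in (0 : ℝ)..t, s ^ (2 * m) *
            ∫ x, inner ℝ (w s x) (gradient (fun y => Φ (y, s)) x))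
      = ∫ s in (0 : ℝ)..t, ∫ x, |v s x| ^ p * Φ (x, s)

/-- `u` is an energy solution on `[0, T)` of
`u_tt - t^(2m) Δu = |u_t|^p`, `u(0) = ε f`, `u_t(0) = ε g`. -/
def IsEnergySolution (N : ℕ) (m p ε : ℝ) (f g : EuclideanSpace ℝ (Fin N) → ℝ)
    (T : EReal) (u : ℝ → L2 N ℝ) : Prop :=
  ∃ (v : ℝ → L2 N ℝ) (w : ℝ → L2 N (EuclideanSpace ℝ (Fin N))),
    IsEnergySolutionWith N m p ε f g T u v w

/-- `supp u ⊆ {(x, t) : |x| ≤ ξ(t) + R}`. -/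
def SupportedInLightCone {N : ℕ} (m R : ℝ) (T : EReal) (u : ℝ → L2 N ℝ) : Prop :=
  ∀ t ∈ timeInterval T, ∀ᵐ x, xi m t + R < ‖x‖ → u t x = 0

/-- The exponent `p_tr(N, m) = 1 + 2 / ((m+1)(N-1) - m)`, read as `+∞` when the denominator is not
positive (for `m ≥ 0` and `N ≥ 1` this happens exactly when `N = 1`). -/
def pTr (N : ℕ) (m : ℝ) : EReal :=
  if (m + 1) * ((N : ℝ) - 1) - m ≤ 0 then ⊤
  else ((1 + 2 / ((m + 1) * ((N : ℝ) - 1) - m) : ℝ) : EReal)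

end

/-!
The proof tests the equation with the plane wave `φ(x) = e^(x₀)`, which satisfies `Δφ = φ`. As the
solution lives in the light cone `|x| ≤ ξ(t) + R`, a cut-off of `φ` beyond the cone is an admissible
test function, and `U(t) = ∫ u φ`, `V(t) = ∫ u_t φ` satisfy `U' = V` and, in integrated form,
`V' ≥ t^(2m) U + ∫ |u_t|^p φ`. By Hölder's inequality the last term is at least
`|V|^p (∫_{|x| ≤ ξ(t) + R} φ)^(1-p)`. Although `φ` is not radial, its mass on a ball is the same as
that of its average over rotations: it is at most a constant times `r^((N-1)/2) e^r`
(`setIntegral_exp_coord_le`). Hence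
`V' ≥ t^(2m) U + κ (1+t)^(-β) e^(-(p-1) ξ(t)) |V|^p` with `β = (m+1)(N-1)(p-1)/2`
(`exists_isSupersolution_of_isEnergySolution`), where a comparison argument replaces `(U, V)` by
differentiable and non-negative functions with the same data (`exists_isSupersolution`).

The linear equation `U'' = t^(2m) U` has a solution with `U' ~ t^(m/2) e^(ξ(t))`. Explicit sub- and
supersolutions of the Riccati equations `b' + b² = t^(2m)` and `a² - a' = t^(2m)` turn this growth
into first-order inequalities: `V` controls `t^m U`
(`IsSupersolution.rpow_mul_fst_le`), and `F ~ t^(-m/2) e^(-ξ) (V + t^m U)` satisfies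
`F' ≥ K t^(-γ) F^p` with `γ = β - m(p-1)/2 = ((m+1)(N-1) - m)(p-1)/2` and `F ≥ c ε` at `t = m + 1`
(`exists_bound_primitive_of_isSupersolution`). Integration bounds `∫ t^(-γ) dt` by a multiple of
`ε^(-(p-1))`, a power of the lifespan if `γ < 1` and its logarithm if `γ = 1`.
-/

/-! ### Differential inequalities in time -/

lemma monotoneOn_Icc_of_hasDerivAt_nonneg {F F' : ℝ → ℝ} {a b : ℝ}
    (hc : ContinuousOn F (Icc a b)) (hd : ∀ t ∈ Ioo a b, HasDerivAt F (F' t) t)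
    (h0 : ∀ t ∈ Ioo a b, 0 ≤ F' t) : MonotoneOn F (Icc a b) := by
  refine monotoneOn_of_deriv_nonneg (convex_Icc a b) hc ?_ ?_
  · rw [interior_Icc]
    exact fun t ht => (hd t ht).differentiableAt.differentiableWithinAt
  · rw [interior_Icc]
    intro t ht
    rw [(hd t ht).deriv]
    exact h0 t ht

lemma hasDerivAt_rpow_const_div {t : ℝ} (ht : 0 < t) (m : ℝ) :
    HasDerivAt (fun s : ℝ => s ^ m) (m * t ^ m / t) t := by
  have h := Real.hasDerivAt_rpow_const (x := t) (p := m) (Or.inl ht.ne')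
  rwa [Real.rpow_sub_one ht.ne', ← mul_div_assoc] at h

lemma hasDerivAt_xi {m t : ℝ} (hm : 0 ≤ m) (ht : 0 < t) : HasDerivAt (xi m) (t ^ m) t := by
  have h := (Real.hasDerivAt_rpow_const (x := t) (p := m + 1) (Or.inl ht.ne')).div_const (m + 1)
  have h1 : m + 1 ≠ 0 := by positivity
  rw [add_sub_cancel_right, mul_div_cancel_left₀ _ h1] at h
  exact h

lemma continuous_xi {m : ℝ} (hm : 0 ≤ m) : Continuous (xi m) :=
  (Real.continuous_rpow_const (by positivity)).div_const _

lemma xi_nonneg {m t : ℝ} (hm : 0 ≤ m) (ht : 0 ≤ t) : 0 ≤ xi m t := by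
  unfold xi; positivity

lemma xi_mono {m s t : ℝ} (hm : 0 ≤ m) (hs : 0 ≤ s) (hst : s ≤ t) : xi m s ≤ xi m t := by
  unfold xi; gcongr

/-- The pair `(U, V)` solves on `[0, S]` the system of differential inequalities `U' = V`,
`V' ≥ t^(2m) U + k(t) V^p`, and is non-negative. -/
structure IsSupersolution (m p S : ℝ) (k U V : ℝ → ℝ) : Prop where
  continuousOn_fst : ContinuousOn U (Icc 0 S)
  continuousOn_snd : ContinuousOn V (Icc 0 S)
  fst_nonneg : ∀ t ∈ Icc 0 S, 0 ≤ U t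
  snd_nonneg : ∀ t ∈ Icc 0 S, 0 ≤ V t
  hasDerivAt_fst : ∀ t ∈ Ioo 0 S, HasDerivAt U (V t) t
  hasDerivAt_snd : ∀ t ∈ Ioo 0 S,
    ∃ V', HasDerivAt V V' t ∧ t ^ (2 * m) * U t + k t * V t ^ p ≤ V'

namespace IsSupersolution

variable {m p S : ℝ} {k U V : ℝ → ℝ}

lemma monotoneOn_fst (h : IsSupersolution m p S k U V) : MonotoneOn U (Icc 0 S) :=
  monotoneOn_Icc_of_hasDerivAt_nonneg h.continuousOn_fst h.hasDerivAt_fst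
    fun t ht => h.snd_nonneg t (Ioo_subset_Icc_self ht)

lemma monotoneOn_snd (h : IsSupersolution m p S k U V) (hk : ∀ t ∈ Icc 0 S, 0 ≤ k t) :
    MonotoneOn V (Icc 0 S) := by
  have hd : ∀ t ∈ Ioo 0 S, HasDerivAt V (deriv V t) t := fun t ht => by
    obtain ⟨V', hV', -⟩ := h.hasDerivAt_snd t ht
    exact hV'.differentiableAt.hasDerivAt
  refine monotoneOn_Icc_of_hasDerivAt_nonneg h.continuousOn_snd hd fun t ht => ?_
  obtain ⟨V', hV', hle⟩ := h.hasDerivAt_snd t ht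
  have ht' := Ioo_subset_Icc_self ht
  rw [hV'.deriv]
  have h1 := h.fst_nonneg t ht'
  have h2 := Real.rpow_nonneg (h.snd_nonneg t ht') p
  have h3 := hk t ht'
  have h4 := Real.rpow_nonneg ht'.1 (2 * m)
  nlinarith [mul_nonneg h4 h1, mul_nonneg h3 h2]

/-- With a subsolution `b ≥ 0` of the Riccati equation `b' + b² = t^(2m)` and a primitive `B`
of `b`, the function `e^B (V - b U)` is non-decreasing. -/
lemma mul_fst_le_snd_of_riccati (h : IsSupersolution m p S k U V)
    (hk : ∀ t ∈ Icc 0 S, 0 ≤ k t) {b b' B : ℝ → ℝ} (hb : ContinuousOn b (Icc 0 S))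
    (hB : ContinuousOn B (Icc 0 S)) (hb0 : b 0 = 0)
    (hdb : ∀ t ∈ Ioo 0 S, HasDerivAt b (b' t) t) (hdB : ∀ t ∈ Ioo 0 S, HasDerivAt B (b t) t)
    (hric : ∀ t ∈ Ioo 0 S, b' t + b t ^ 2 ≤ t ^ (2 * m)) {t : ℝ} (ht : t ∈ Icc 0 S) :
    b t * U t ≤ V t := by
  choose! V' hV' hle using h.hasDerivAt_snd
  have hmono : MonotoneOn (fun t => Real.exp (B t) * (V t - b t * U t)) (Icc 0 S) := by
    refine monotoneOn_Icc_of_hasDerivAt_nonneg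
      (F' := fun t => Real.exp (B t) * b t * (V t - b t * U t)
        + Real.exp (B t) * (V' t - (b' t * U t + b t * V t))) ?_ ?_ ?_
    · exact (hB.rexp).mul (h.continuousOn_snd.sub (hb.mul h.continuousOn_fst))
    · intro s hs
      exact ((hdB s hs).exp).mul ((hV' s hs).sub ((hdb s hs).mul (h.hasDerivAt_fst s hs)))
    · intro s hs
      have hs' := Ioo_subset_Icc_self hs
      have h1 := h.fst_nonneg s hs'
      have h2 := mul_nonneg (hk s hs') (Real.rpow_nonneg (h.snd_nonneg s hs') p)
      have h3 := hle s hs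
      have h4 : 0 ≤ (s ^ (2 * m) - (b' s + b s ^ 2)) * U s :=
        mul_nonneg (sub_nonneg.2 (hric s hs)) h1
      have h5 : 0 ≤ b s * (V s - b s * U s) + (V' s - (b' s * U s + b s * V s)) := by
        linarith
      have h6 := mul_nonneg (Real.exp_pos (B s)).le h5
      linarith
  have h0 : (0 : ℝ) ∈ Icc 0 S := ⟨le_rfl, ht.1.trans ht.2⟩
  have h1 := hmono h0 ht ht.1
  simp only [hb0, zero_mul, sub_zero] at h1
  have h2 := mul_nonneg (Real.exp_pos (B 0)).le (h.snd_nonneg 0 h0)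
  have h3 := nonneg_of_mul_nonneg_right (h2.trans h1) (Real.exp_pos (B t))
  linarith

/-- `V` controls `t^m U`. The Riccati subsolution is `b = δ ζ'` with `ζ = (1 + t^(2m+2))^(1/2)` and
`δ = 1 / (2 (m+1)²)`. -/
lemma rpow_mul_fst_le (h : IsSupersolution m p S k U V) (hm : 0 ≤ m)
    (hk : ∀ t ∈ Icc 0 S, 0 ≤ k t) {t : ℝ} (ht : t ∈ Icc 0 S) (ht1 : 1 ≤ t) :
    t ^ m * U t ≤ 4 * (m + 1) * V t := by
  set ζ : ℝ → ℝ := fun s => √(1 + (s ^ m * s) ^ 2) with hζ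
  have hζ1 : ∀ s, 1 ≤ ζ s := fun s => by
    rw [hζ]; exact Real.one_le_sqrt.2 (by nlinarith [sq_nonneg (s ^ m * s)])
  have hζsq : ∀ s, ζ s ^ 2 = 1 + (s ^ m * s) ^ 2 := fun s => Real.sq_sqrt (by positivity)
  have hζc : Continuous ζ := by
    have := Real.continuous_rpow_const hm
    rw [hζ]; fun_prop
  have hpow : ∀ s : ℝ, 0 < s → HasDerivAt (fun s : ℝ => s ^ m) (m * s ^ m / s) s :=
    fun s hs => hasDerivAt_rpow_const_div hs m
  have hζd : ∀ s, 0 < s → HasDerivAt ζ ((m + 1) * ((s ^ m) ^ 2 * s) / ζ s) s := by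
    intro s hs
    have h1 : HasDerivAt (fun s : ℝ => 1 + (s ^ m * s) ^ 2) _ s :=
      (((hpow s hs).mul (hasDerivAt_id s)).pow 2).const_add 1
    have h2 := h1.sqrt (by positivity)
    refine h2.congr_deriv ?_
    have h3 : √(1 + (s ^ m * s) ^ 2) ≠ 0 := by positivity
    have h4 : s ≠ 0 := hs.ne'
    simp only [hζ, id, Pi.mul_apply]
    field_simp
    ring
  have hm1 : 0 < m + 1 := by positivity
  set δ : ℝ := 1 / (2 * (m + 1) ^ 2) with hδ
  have hδ0 : 0 < δ := by positivity
  have key := h.mul_fst_le_snd_of_riccati hk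
    (b := fun s => δ * ((m + 1) * ((s ^ m) ^ 2 * s) / ζ s))
    (b' := fun s => δ * (((m + 1) * ((2 * m + 1) * (s ^ m) ^ 2) * ζ s
      - (m + 1) * ((s ^ m) ^ 2 * s) * ((m + 1) * ((s ^ m) ^ 2 * s) / ζ s)) / ζ s ^ 2))
    (B := fun s => δ * ζ s) ?_ ?_ ?_ ?_ ?_ ?_ ht
  · set x := t ^ m with hx
    have hx0 : 0 ≤ x := Real.rpow_nonneg ht.1 m
    have hx1 : 1 ≤ x := Real.one_le_rpow ht1 hm
    have hU := h.fst_nonneg t ht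
    have hζle : ζ t ≤ 2 * (x * t) := by
      have h1 : 1 ≤ x * t := by nlinarith
      have := hζsq t
      rw [← hx] at this
      nlinarith [hζ1 t]
    have hζp : 0 < ζ t := lt_of_lt_of_le one_pos (hζ1 t)
    have hb : x / (4 * (m + 1)) ≤ δ * ((m + 1) * (x ^ 2 * t) / ζ t) := by
      rw [hδ, div_le_iff₀ (by positivity)]
      have : 1 / (2 * (m + 1) ^ 2) * ((m + 1) * (x ^ 2 * t) / ζ t) * (4 * (m + 1))
          = x * (2 * (x * t)) / ζ t := by
        field_simp; ring
      rw [this, le_div_iff₀ hζp]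
      exact mul_le_mul_of_nonneg_left hζle hx0
    have h3 := (mul_le_mul_of_nonneg_right hb hU).trans key
    rw [div_mul_eq_mul_div, div_le_iff₀ (by positivity)] at h3
    linarith
  · have := Real.continuous_rpow_const hm
    exact Continuous.continuousOn (continuous_const.mul ((by fun_prop : Continuous
      fun s : ℝ => (m + 1) * ((s ^ m) ^ 2 * s)).div hζc
        fun s => (lt_of_lt_of_le one_pos (hζ1 s)).ne'))
  · exact (continuous_const.mul hζc).continuousOn
  · simp
  · intro s hs
    have hs0 : 0 < s := hs.1
    have h1 := ((((hpow s hs0).pow 2).mul (hasDerivAt_id s)).const_mul (m + 1))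
    refine ((h1.div (hζd s hs0) (lt_of_lt_of_le one_pos (hζ1 s)).ne').const_mul δ).congr_deriv ?_
    congr 3
    simp only [id, Pi.pow_apply]
    field_simp
    ring
  · intro s hs
    exact (hζd s hs.1).const_mul δ
  · intro s hs
    have hs0 : 0 < s := hs.1
    have h2 : s ^ (2 * m) = (s ^ m) ^ 2 := by
      rw [mul_comm, Real.rpow_mul hs0.le, Real.rpow_two]
    rw [h2]
    set x := s ^ m with hx
    have hx0 : 0 < x := Real.rpow_pos_of_pos hs0 m
    have hz := hζ1 s
    have hzsq := hζsq s
    rw [← hx] at hzsq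
    set z := ζ s
    have hz0 : 0 < z := by linarith
    have e1 : ((m + 1) * ((2 * m + 1) * x ^ 2) * z
        - (m + 1) * (x ^ 2 * s) * ((m + 1) * (x ^ 2 * s) / z)) / z ^ 2
        ≤ (m + 1) * (2 * m + 1) * x ^ 2 := by
      rw [div_le_iff₀ (by positivity)]
      have : 0 ≤ (m + 1) * (x ^ 2 * s) * ((m + 1) * (x ^ 2 * s) / z) := by positivity
      have h5 : (m + 1) * (2 * m + 1) * x ^ 2 * z ≤ (m + 1) * (2 * m + 1) * x ^ 2 * z ^ 2 := by
        gcongr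
        nlinarith
      linarith
    have e2 : ((m + 1) * (x ^ 2 * s) / z) ^ 2 ≤ (m + 1) ^ 2 * x ^ 2 := by
      rw [div_pow, div_le_iff₀ (by positivity), hzsq]
      have : 0 ≤ (m + 1) ^ 2 * x ^ 2 := by positivity
      nlinarith
    have e3 : δ * ((m + 1) * (2 * m + 1)) + δ ^ 2 * (m + 1) ^ 2 ≤ 1 := by
      have : δ * ((m + 1) * (2 * m + 1)) + δ ^ 2 * (m + 1) ^ 2
          = (2 * (m + 1) * (2 * m + 1) + 1) / (4 * (m + 1) ^ 2) := by
        rw [hδ]; field_simp; ring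
      rw [this, div_le_one (by positivity)]
      nlinarith
    calc _ ≤ δ * ((m + 1) * (2 * m + 1) * x ^ 2) + δ ^ 2 * ((m + 1) ^ 2 * x ^ 2) := by
          rw [mul_pow]; gcongr
      _ = (δ * ((m + 1) * (2 * m + 1)) + δ ^ 2 * (m + 1) ^ 2) * x ^ 2 := by ring
      _ ≤ 1 * x ^ 2 := by gcongr
      _ = x ^ 2 := one_mul _

end IsSupersolution

/-- With the weight `k(t) = κ (1+t)^(-β) e^(-(p-1) ξ(t))` and data of size `ε`, a supersolution on
`[0, S]` can exist only as long as `∫ t^(-γ) dt`, over `[m+1, S]` and with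
`γ = β - m (p-1) / 2`, stays below `K ε^(-(p-1))`. The integral is expressed by a primitive `P`.

The functional that blows up is `F = e^(-A) (V + A' U)`, where `A' = t^m + m / (2t) - c / t^(m+2)`
satisfies `A'' + t^(2m) ≥ (A')²` for `t ≥ m + 1`; thus `F' ≥ e^(-A) k V^p`. As `V` controls `A' U`
and `e^A` grows like `t^(m/2) e^ξ`, this gives `F' ≥ K₀ t^(-γ) F^p`. -/
theorem exists_bound_primitive_of_isSupersolution {m p β κ U₀ V₀ : ℝ} (hm : 0 ≤ m) (hp : 1 < p)
    (hβ : 0 ≤ β) (hκ : 0 < κ) (hU₀ : 0 ≤ U₀) (hV₀ : 0 ≤ V₀) (h₀ : 0 < U₀ + V₀) :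
    ∃ K > (0 : ℝ), ∀ ε > (0 : ℝ), ∀ S ≥ m + 1, ∀ U V P : ℝ → ℝ,
      IsSupersolution m p S
        (fun t => κ * (1 + t) ^ (-β) * Real.exp (-((p - 1) * xi m t))) U V →
      U 0 = ε * U₀ → V 0 = ε * V₀ →
      (∀ t > 0, HasDerivAt P (t ^ (-(β - m * (p - 1) / 2))) t) →
      P S - P (m + 1) ≤ K * ε ^ (-(p - 1)) := by
  have hm1 : 0 < m + 1 := by positivity
  have hp1 : 0 < p - 1 := by linarith
  -- this `c` cancels the terms of order `t^(-2)` in the Riccati inequality for `a = A'`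
  set c : ℝ := m * (m + 2) / 8 with hc
  have hc0 : 0 ≤ c := by positivity
  set a : ℝ → ℝ := fun t => t ^ m + m / (2 * t) - c / (t ^ m * t ^ 2) with ha
  set a' : ℝ → ℝ := fun t => m * t ^ m / t - m / (2 * t ^ 2) + c * (m + 2) / (t ^ m * t ^ 3)
    with ha'
  set A : ℝ → ℝ := fun t => xi m t + m / 2 * Real.log t + c / (m + 1) / (t ^ m * t) with hA
  -- from `a ≤ 3/2 t^m` and `t^m U ≤ 4 (m+1) V`
  set c₁ : ℝ := 1 / (1 + 6 * (m + 1)) with hc₁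
  have hc₁0 : 0 < c₁ := by positivity
  set K₀ : ℝ := κ * c₁ ^ p * 2 ^ (-β) with hK₀
  have hK₀0 : 0 < K₀ := by positivity
  -- a lower bound for `F (m+1) / ε`, as `a ≥ 7/8` and `U`, `V` are non-decreasing
  set c₂ : ℝ := Real.exp (-A (m + 1)) * (7 / 8 * (U₀ + V₀)) with hc₂
  have hc₂0 : 0 < c₂ := by positivity
  refine ⟨c₂ ^ (-(p - 1)) / ((p - 1) * K₀), by positivity, ?_⟩
  intro ε hε S hS U V P h hU hV hP
  have hk : ∀ t ∈ Icc 0 S, 0 ≤ κ * (1 + t) ^ (-β) * Real.exp (-((p - 1) * xi m t)) := by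
    intro t ht
    have := ht.1
    positivity
  have hsub : Icc (m + 1) S ⊆ Icc 0 S := Icc_subset_Icc_left hm1.le
  have hsub' : Ioo (m + 1) S ⊆ Ioo 0 S := Ioo_subset_Ioo_left hm1.le
  have hdA : ∀ t, 0 < t → HasDerivAt A (a t) t := by
    intro t ht
    have h1 : HasDerivAt A _ t := ((hasDerivAt_xi hm ht).add
      ((Real.hasDerivAt_log ht.ne').const_mul (m / 2))).add
      (((hasDerivAt_rpow_const_div ht m).mul (hasDerivAt_id t)).fun_inv
        (by simpa using ⟨(Real.rpow_pos_of_pos ht m).ne', ht.ne'⟩) |>.const_mul (c / (m + 1)))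
    refine h1.congr_deriv ?_
    have := (Real.rpow_pos_of_pos ht m).ne'
    have h0 := ht.ne'
    simp only [ha, id, Pi.mul_apply]
    field_simp
    ring
  have hda : ∀ t, 0 < t → HasDerivAt a (a' t) t := by
    intro t ht
    have h1 : HasDerivAt a _ t := ((hasDerivAt_rpow_const_div ht m).add
      (((hasDerivAt_id t).const_mul 2).fun_inv (by simpa using ht.ne') |>.const_mul m)).sub
      (((hasDerivAt_rpow_const_div ht m).mul (hasDerivAt_pow 2 t)).fun_inv
        (by simpa using ⟨(Real.rpow_pos_of_pos ht m).ne', ht.ne'⟩) |>.const_mul c)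
    refine h1.congr_deriv ?_
    have := (Real.rpow_pos_of_pos ht m).ne'
    have h0 := ht.ne'
    simp only [ha', id, Pi.mul_apply]
    field_simp
    ring
  have hone : ∀ t, m + 1 ≤ t → 1 ≤ t ^ m ∧ 1 ≤ t := fun t ht =>
    ⟨Real.one_le_rpow (by linarith) hm, by linarith⟩
  have hric : ∀ t, m + 1 ≤ t → a t ^ 2 ≤ t ^ (2 * m) + a' t := by
    intro t ht
    obtain ⟨hx1, ht1⟩ := hone t ht
    have ht0 : 0 < t := by linarith
    rw [show t ^ (2 * m) = (t ^ m) ^ 2 by rw [mul_comm, Real.rpow_mul ht0.le, Real.rpow_two]]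
    simp only [ha, ha']
    set x := t ^ m
    have hx0 : 0 < x := by linarith
    have e : x ^ 2 + (m * x / t - m / (2 * t ^ 2) + c * (m + 2) / (x * t ^ 3))
        - (x + m / (2 * t) - c / (x * t ^ 2)) ^ 2
        = c * (2 * (m + 1) * (x * t) - c) / (x ^ 2 * t ^ 4) := by
      rw [hc]; field_simp; ring
    have h2 : 0 ≤ 2 * (m + 1) * (x * t) - c := by
      have : m + 1 ≤ x * t := by nlinarith
      have : (m + 1) * (m + 1) ≤ (m + 1) * (x * t) := by gcongr
      rw [hc]; nlinarith
    have h3 : 0 ≤ c * (2 * (m + 1) * (x * t) - c) / (x ^ 2 * t ^ 4) := by positivity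
    linarith
  have hale : ∀ t, m + 1 ≤ t → 7 / 8 ≤ a t ∧ a t ≤ 3 / 2 * t ^ m := by
    intro t ht
    obtain ⟨hx1, ht1⟩ := hone t ht
    have ht0 : 0 < t := by linarith
    simp only [ha]
    set x := t ^ m
    have hx0 : 0 < x := by linarith
    have h1 : m / (2 * t) ≤ 1 / 2 := by
      rw [div_le_iff₀ (by positivity)]; linarith
    have h2 : c / (x * t ^ 2) ≤ 1 / 8 := by
      rw [div_le_iff₀ (by positivity), hc]; nlinarith [mul_le_mul hx1 (pow_le_pow_left₀ hm1.le ht 2)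
        (by positivity) hx0.le]
    have h3 : 0 ≤ m / (2 * t) := by positivity
    have h4 : 0 ≤ c / (x * t ^ 2) := by positivity
    constructor <;> linarith
  choose! V' hV' hle using h.hasDerivAt_snd
  -- `V` controls `V + a U`
  have hVZ : ∀ t ∈ Icc (m + 1) S, c₁ * (V t + a t * U t) ≤ V t := by
    intro t ht
    have h1 := h.rpow_mul_fst_le hm hk (hsub ht) (hone t ht.1).2
    have h2 := mul_le_mul_of_nonneg_right (hale t ht.1).2 (h.fst_nonneg t (hsub ht))
    rw [hc₁, one_div_mul_eq_div, div_le_iff₀ (by positivity)]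
    linarith
  set F : ℝ → ℝ := fun t => Real.exp (-A t) * (V t + a t * U t) with hF
  set F' : ℝ → ℝ := fun t => Real.exp (-A t) * (-a t) * (V t + a t * U t)
    + Real.exp (-A t) * (V' t + (a' t * U t + a t * V t)) with hF'
  have hdF : ∀ t ∈ Ioo (m + 1) S, HasDerivAt F (F' t) t := by
    intro t ht
    have ht0 := (hsub' ht).1
    exact ((hdA t ht0).neg.exp).mul ((hV' t (hsub' ht)).add
      ((hda t ht0).mul (h.hasDerivAt_fst t (hsub' ht))))
  have hcF : ContinuousOn F (Icc (m + 1) S) := by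
    have h1 : ContinuousOn A (Icc (m + 1) S) := fun t ht =>
      (hdA t (hm1.trans_le ht.1)).continuousAt.continuousWithinAt
    have h2 : ContinuousOn a (Icc (m + 1) S) := fun t ht =>
      (hda t (hm1.trans_le ht.1)).continuousAt.continuousWithinAt
    exact (h1.neg.rexp).mul ((h.continuousOn_snd.mono hsub).add
      (h2.mul (h.continuousOn_fst.mono hsub)))
  have hF0 : ∀ t ∈ Icc (m + 1) S, c₂ * ε ≤ F (m + 1) ∧ 0 ≤ F t := by
    intro t ht
    have hl : m + 1 ∈ Icc (m + 1) S := ⟨le_rfl, hS⟩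
    have h00 : (0 : ℝ) ∈ Icc 0 S := ⟨le_rfl, hm1.le.trans hS⟩
    have h1 := h.monotoneOn_fst h00 (hsub hl) hm1.le
    have h2 := h.monotoneOn_snd hk h00 (hsub hl) hm1.le
    rw [hU] at h1
    rw [hV] at h2
    constructor
    · have h3 := (hale (m + 1) le_rfl).1
      have h4 : 7 / 8 * (ε * U₀) ≤ a (m + 1) * U (m + 1) := by gcongr
      have h5 : 0 ≤ ε * V₀ := by positivity
      simp only [hF, hc₂]
      rw [mul_assoc]
      gcongr
      linarith
    · have h3 := (hale t ht.1).1
      have h4 := h.fst_nonneg t (hsub ht)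
      have h5 := h.snd_nonneg t (hsub ht)
      simp only [hF]
      have : 0 ≤ a t := by linarith
      positivity
  have hF'ge : ∀ t ∈ Ioo (m + 1) S,
      K₀ * t ^ (-(β - m * (p - 1) / 2)) * F t ^ p ≤ F' t := by
    intro t ht
    have ht' := Ioo_subset_Icc_self ht
    obtain ⟨hx1, ht1⟩ := hone t ht'.1
    have ht0 : 0 < t := by linarith
    have hUt := h.fst_nonneg t (hsub ht')
    have hVt := h.snd_nonneg t (hsub ht')
    have hat : 0 ≤ a t := by linarith [(hale t ht'.1).1]
    have step1 : Real.exp (-A t) *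
        (κ * (1 + t) ^ (-β) * Real.exp (-((p - 1) * xi m t)) * V t ^ p) ≤ F' t := by
      have h1 := hle t (hsub' ht)
      have h2 := mul_nonneg (sub_nonneg.2 (hric t ht'.1)) hUt
      have h3 : κ * (1 + t) ^ (-β) * Real.exp (-((p - 1) * xi m t)) * V t ^ p
          ≤ -a t * (V t + a t * U t) + (V' t + (a' t * U t + a t * V t)) := by linarith
      have h4 := mul_le_mul_of_nonneg_left h3 (Real.exp_pos (-A t)).le
      simp only [hF']
      linarith
    refine le_trans ?_ step1
    have hZ : V t + a t * U t = Real.exp (A t) * F t := by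
      simp only [hF]; rw [← mul_assoc, ← Real.exp_add]; simp
    have hFt : 0 ≤ F t := (hF0 t ht').2
    have hVp : c₁ ^ p * (Real.exp (p * A t) * F t ^ p) ≤ V t ^ p := by
      have h1 := Real.rpow_le_rpow (by positivity) (hVZ t ht') (by linarith : 0 ≤ p)
      rw [hZ, Real.mul_rpow hc₁0.le (by positivity), Real.mul_rpow (Real.exp_pos _).le hFt,
        ← Real.exp_mul, mul_comm (A t) p] at h1
      exact h1
    have h1t : 2 ^ (-β) * t ^ (-β) ≤ (1 + t) ^ (-β) := by
      rw [← Real.mul_rpow (by norm_num) ht0.le]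
      exact Real.rpow_le_rpow_of_nonpos (by linarith) (by linarith) (by linarith)
    have hexp : t ^ (m * (p - 1) / 2) ≤
        Real.exp (-A t) * Real.exp (-((p - 1) * xi m t)) * Real.exp (p * A t) := by
      rw [← Real.exp_add, ← Real.exp_add, Real.rpow_def_of_pos ht0]
      refine Real.exp_le_exp.2 ?_
      have h2 : 0 ≤ c / (m + 1) / (t ^ m * t) := by positivity
      have h3 : 0 ≤ (p - 1) * (c / (m + 1) / (t ^ m * t)) := by positivity
      simp only [hA]
      linarith
    have hsplit : t ^ (-(β - m * (p - 1) / 2)) = t ^ (-β) * t ^ (m * (p - 1) / 2) := by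
      rw [← Real.rpow_add ht0]; ring_nf
    calc K₀ * t ^ (-(β - m * (p - 1) / 2)) * F t ^ p
        = κ * c₁ ^ p * (2 ^ (-β) * t ^ (-β)) * t ^ (m * (p - 1) / 2) * F t ^ p := by
          rw [hsplit, hK₀]; ring
      _ ≤ κ * c₁ ^ p * (1 + t) ^ (-β) *
          (Real.exp (-A t) * Real.exp (-((p - 1) * xi m t)) * Real.exp (p * A t)) * F t ^ p := by
          gcongr
      _ = Real.exp (-A t) * (κ * (1 + t) ^ (-β) * Real.exp (-((p - 1) * xi m t)) *
          (c₁ ^ p * (Real.exp (p * A t) * F t ^ p))) := by ring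
      _ ≤ _ := by gcongr
  have hl : m + 1 ∈ Icc (m + 1) S := ⟨le_rfl, hS⟩
  have hr : S ∈ Icc (m + 1) S := ⟨hS, le_rfl⟩
  have hFmono : MonotoneOn F (Icc (m + 1) S) :=
    monotoneOn_Icc_of_hasDerivAt_nonneg hcF hdF fun t ht => by
      have h1 := hF'ge t ht
      have h2 := (hF0 t (Ioo_subset_Icc_self ht)).2
      have h3 : 0 < t := (hsub' ht).1
      exact le_trans (by positivity) h1
  have hFpos : ∀ t ∈ Icc (m + 1) S, 0 < F t := fun t ht =>
    lt_of_lt_of_le (by positivity) ((hF0 t ht).1.trans (hFmono hl ht ht.1))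
  -- `F^(1-p)` decreases at least as fast as `(p-1) K₀ P` increases
  have hG : MonotoneOn (fun t => -(F t ^ (-(p - 1))) - (p - 1) * K₀ * P t) (Icc (m + 1) S) := by
    refine monotoneOn_Icc_of_hasDerivAt_nonneg
      (F' := fun t => -(F' t * (-(p - 1)) * F t ^ (-(p - 1) - 1))
        - (p - 1) * K₀ * t ^ (-(β - m * (p - 1) / 2))) ?_ ?_ ?_
    · refine ((hcF.rpow_const fun t ht => Or.inl (hFpos t ht).ne').neg).sub
        (continuousOn_const.mul fun t ht => ?_)
      exact (hP t (hm1.trans_le ht.1)).continuousAt.continuousWithinAt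
    · intro t ht
      exact (((hdF t ht).rpow_const (Or.inl (hFpos t (Ioo_subset_Icc_self ht)).ne')).neg).sub
        ((hP t (hsub' ht).1).const_mul _)
    · intro t ht
      have h1 := hF'ge t ht
      have h2 := hFpos t (Ioo_subset_Icc_self ht)
      have h3 : F t ^ p * F t ^ (-(p - 1) - 1) = 1 := by
        rw [← Real.rpow_add h2]; ring_nf; simp
      have h4 := mul_le_mul_of_nonneg_right h1 (Real.rpow_nonneg h2.le (-(p - 1) - 1))
      rw [mul_assoc, h3, mul_one] at h4
      have h5 := mul_le_mul_of_nonneg_left h4 hp1.le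
      linarith
  have hfin := hG hl hr hS
  simp only at hfin
  have h1 : 0 ≤ F S ^ (-(p - 1)) := Real.rpow_nonneg (hFpos S hr).le _
  have h2 : F (m + 1) ^ (-(p - 1)) ≤ c₂ ^ (-(p - 1)) * ε ^ (-(p - 1)) := by
    rw [← Real.mul_rpow hc₂0.le hε.le]
    exact Real.rpow_le_rpow_of_nonpos (by positivity) (hF0 S hr).1 (by linarith)
  rw [div_mul_eq_mul_div, le_div_iff₀ (by positivity)]
  linarith

/-- Subcritical lifespan bound: `γ < 1`. -/
theorem exists_rpow_bound_of_isSupersolution {m p β κ U₀ V₀ : ℝ} (hm : 0 ≤ m) (hp : 1 < p)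
    (hβ : 0 ≤ β) (hκ : 0 < κ) (hU₀ : 0 ≤ U₀) (hV₀ : 0 ≤ V₀) (h₀ : 0 < U₀ + V₀)
    (hγ : β - m * (p - 1) / 2 < 1) :
    ∃ C > (0 : ℝ), ∀ ε > (0 : ℝ), ε ≤ 1 → ∀ S > 0, ∀ U V : ℝ → ℝ,
      IsSupersolution m p S
        (fun t => κ * (1 + t) ^ (-β) * Real.exp (-((p - 1) * xi m t))) U V →
      U 0 = ε * U₀ → V 0 = ε * V₀ →
      S ≤ C * ε ^ (-((p - 1) / (1 - (β - m * (p - 1) / 2)))) := by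
  obtain ⟨K, hK, H⟩ := exists_bound_primitive_of_isSupersolution hm hp hβ hκ hU₀ hV₀ h₀
  set γ := β - m * (p - 1) / 2
  have hq : 0 < 1 - γ := by linarith
  have hm1 : 0 < m + 1 := by positivity
  have hp1 : 0 < p - 1 := by linarith
  set M := (1 - γ) * K + (m + 1) ^ (1 - γ) with hM
  have hM0 : 0 < M := by positivity
  refine ⟨M ^ (1 / (1 - γ)), by positivity, ?_⟩
  intro ε hε hε1 S hS U V h hU hV
  have hεp : 1 ≤ ε ^ (-(p - 1)) := Real.one_le_rpow_of_pos_of_le_one_of_nonpos hε hε1 (by linarith)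
  have key : S ^ (1 - γ) ≤ M * ε ^ (-(p - 1)) := by
    have h5 : (m + 1) ^ (1 - γ) ≤ (m + 1) ^ (1 - γ) * ε ^ (-(p - 1)) :=
      le_mul_of_one_le_right (by positivity) hεp
    rcases le_total S (m + 1) with hSm | hSm
    · have h4 : S ^ (1 - γ) ≤ (m + 1) ^ (1 - γ) := Real.rpow_le_rpow hS.le hSm hq.le
      have h6 : 0 ≤ (1 - γ) * K * ε ^ (-(p - 1)) := by positivity
      rw [hM, add_mul]
      linarith
    · have h1 := H ε hε S hSm U V (fun t => t ^ (1 - γ) / (1 - γ)) h hU hV (fun t ht => by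
        have h2 := (Real.hasDerivAt_rpow_const (x := t) (p := 1 - γ)
          (Or.inl ht.ne')).div_const (1 - γ)
        rwa [mul_div_cancel_left₀ _ hq.ne', show 1 - γ - 1 = -γ by ring] at h2)
      rw [← sub_div, div_le_iff₀ hq] at h1
      rw [hM, add_mul]
      linarith
  have h3 := Real.rpow_le_rpow (by positivity) key (by positivity : 0 ≤ 1 / (1 - γ))
  rw [← Real.rpow_mul hS.le, mul_one_div_cancel hq.ne', Real.rpow_one,
    Real.mul_rpow hM0.le (by positivity), ← Real.rpow_mul hε.le] at h3
  rwa [show -(p - 1) * (1 / (1 - γ)) = -((p - 1) / (1 - γ)) by ring] at h3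

/-- Critical lifespan bound: `γ = 1`. -/
theorem exists_exp_bound_of_isSupersolution {m p β κ U₀ V₀ : ℝ} (hm : 0 ≤ m) (hp : 1 < p)
    (hβ : 0 ≤ β) (hκ : 0 < κ) (hU₀ : 0 ≤ U₀) (hV₀ : 0 ≤ V₀) (h₀ : 0 < U₀ + V₀)
    (hγ : β - m * (p - 1) / 2 = 1) :
    ∃ C > (0 : ℝ), ∀ ε > (0 : ℝ), ε ≤ 1 → ∀ S > 0, ∀ U V : ℝ → ℝ,
      IsSupersolution m p S
        (fun t => κ * (1 + t) ^ (-β) * Real.exp (-((p - 1) * xi m t))) U V →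
      U 0 = ε * U₀ → V 0 = ε * V₀ → S ≤ Real.exp (C * ε ^ (-(p - 1))) := by
  obtain ⟨K, hK, H⟩ := exists_bound_primitive_of_isSupersolution hm hp hβ hκ hU₀ hV₀ h₀
  have hm1 : 0 < m + 1 := by positivity
  have hlog : 0 ≤ Real.log (m + 1) := Real.log_nonneg (by linarith)
  refine ⟨K + Real.log (m + 1), by positivity, ?_⟩
  intro ε hε hε1 S hS U V h hU hV
  have hεp : 1 ≤ ε ^ (-(p - 1)) := Real.one_le_rpow_of_pos_of_le_one_of_nonpos hε hε1 (by linarith)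
  have h5 : Real.log (m + 1) ≤ Real.log (m + 1) * ε ^ (-(p - 1)) :=
    le_mul_of_one_le_right hlog hεp
  rw [← Real.log_le_iff_le_exp hS, add_mul]
  rcases le_total S (m + 1) with hSm | hSm
  · have h6 := Real.log_le_log hS hSm
    have h7 : 0 ≤ K * ε ^ (-(p - 1)) := by positivity
    linarith
  · have h1 := H ε hε S hSm U V Real.log h hU hV fun t ht => by
      rw [hγ, Real.rpow_neg_one]
      exact Real.hasDerivAt_log ht.ne'
    linarith

lemma exists_primitive_Icc {S : ℝ} (hS : 0 ≤ S) {H : ℝ → ℝ} (hH : ContinuousOn H (Icc 0 S))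
    (y : ℝ) : ∃ G : ℝ → ℝ, Continuous G ∧ G 0 = y ∧ (∀ t ∈ Ioo 0 S, HasDerivAt G (H t) t) ∧
      ∀ t ∈ Icc 0 S, G t = y + ∫ s in (0 : ℝ)..t, H s := by
  have hc : Continuous (IccExtend hS ((Icc 0 S).domRestrict H)) :=
    (continuousOn_iff_continuous_domRestrict.1 hH).Icc_extend'
  have he : ∀ s ∈ Icc 0 S, IccExtend hS ((Icc 0 S).domRestrict H) s = H s := fun s hs => by
    rw [IccExtend_of_mem _ _ hs, domRestrict_apply]
  refine ⟨fun t => y + ∫ s in (0 : ℝ)..t, IccExtend hS ((Icc 0 S).domRestrict H) s, ?_, by simp,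
    fun t ht => ?_, fun t ht => ?_⟩
  · exact continuous_const.add (intervalIntegral.continuous_primitive
      (fun a b => hc.intervalIntegrable a b) 0)
  · rw [← he t (Ioo_subset_Icc_self ht)]
    exact (hc.integral_hasStrictDerivAt 0 t).hasDerivAt.const_add y
  · simp only
    congr 1
    refine intervalIntegral.integral_congr fun s hs => he s ?_
    rw [uIcc_of_le ht.1] at hs
    exact ⟨hs.1, hs.2.trans ht.2⟩

/-- Solutions of `U'' ≥ t^(2m) U` in integrated form, with non-negative data, are non-negative:
otherwise look at the minimum of `U e^(-λ t)` for a large `λ`. -/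
lemma nonneg_of_integral_le {m S : ℝ} (hm : 0 ≤ m) {U V H : ℝ → ℝ}
    (hU : ContinuousOn U (Icc 0 S)) (hd : ∀ t ∈ Ioo 0 S, HasDerivAt U (V t) t)
    (hU0 : 0 ≤ U 0) (hV0 : 0 ≤ V 0) (hH : ContinuousOn H (Icc 0 S))
    (hHU : ∀ t ∈ Icc 0 S, t ^ (2 * m) * U t ≤ H t)
    (hV : ∀ t ∈ Icc 0 S, V 0 + ∫ s in (0 : ℝ)..t, H s ≤ V t) :
    ∀ t ∈ Icc 0 S, 0 ≤ U t := by
  intro t ht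
  have hS : 0 ≤ S := ht.1.trans ht.2
  set K : ℝ := S ^ (2 * m) with hK
  have hK0 : 0 ≤ K := Real.rpow_nonneg hS _
  set l : ℝ := K + 1 with hl
  have hl0 : 0 < l := by positivity
  obtain ⟨s₀, hs₀, hmin⟩ := isCompact_Icc.exists_isMinOn (nonempty_Icc.2 hS)
    (hU.mul (by fun_prop : ContinuousOn (fun t => Real.exp (-(l * t))) (Icc 0 S)))
  by_contra hneg
  push Not at hneg
  set M : ℝ := -(U s₀ * Real.exp (-(l * s₀))) with hM
  have hge : ∀ s ∈ Icc 0 S, -(M * Real.exp (l * s)) ≤ U s := by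
    intro s hs
    have h1 : U s₀ * Real.exp (-(l * s₀)) ≤ U s * Real.exp (-(l * s)) := hmin hs
    have h2 := mul_le_mul_of_nonneg_right h1 (Real.exp_pos (l * s)).le
    rw [mul_assoc (U s), ← Real.exp_add, neg_add_cancel, Real.exp_zero, mul_one] at h2
    rw [hM]; linarith
  have hM0 : 0 < M := by
    by_contra h
    have := hge t ht
    have h3 := mul_nonneg (neg_nonneg.2 (not_lt.1 h)) (Real.exp_pos (l * t)).le
    linarith
  have hdexp : ∀ s : ℝ, HasDerivAt (fun s => Real.exp (l * s)) (Real.exp (l * s) * l) s :=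
    fun s => by simpa using ((hasDerivAt_id s).const_mul l).exp
  obtain ⟨G, hGc, hG0, hGd, hGe⟩ := exists_primitive_Icc hS hH (V 0)
  have hG : ∀ s ∈ Icc 0 S, -(K * M / l * Real.exp (l * s)) ≤ V s := by
    have hmono : MonotoneOn (fun s => G s + K * M / l * Real.exp (l * s)) (Icc 0 S) := by
      refine monotoneOn_Icc_of_hasDerivAt_nonneg
        (by fun_prop) (fun s hs => (hGd s hs).add ((hdexp s).const_mul _)) fun s hs => ?_
      have hs' := Ioo_subset_Icc_self hs
      have h1 : -(K * (M * Real.exp (l * s))) ≤ s ^ (2 * m) * U s := by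
        have h2 : 0 ≤ s ^ (2 * m) := Real.rpow_nonneg hs'.1 _
        have h3 : s ^ (2 * m) ≤ K := Real.rpow_le_rpow hs'.1 hs'.2 (by positivity)
        have h4 := mul_le_mul_of_nonneg_left (hge s hs') h2
        have h5 := mul_le_mul_of_nonneg_right h3 (mul_pos hM0 (Real.exp_pos (l * s))).le
        linarith
      have h2 := hHU s hs'
      have h3 : K * M / l * (Real.exp (l * s) * l) = K * (M * Real.exp (l * s)) := by
        field_simp
      rw [h3]; linarith
    intro s hs
    have h1 := hmono ⟨le_rfl, hS⟩ hs hs.1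
    simp only [hG0] at h1
    have h2 := hV s hs
    rw [← hGe s hs] at h2
    have h3 : 0 ≤ K * M / l * Real.exp (l * 0) := by positivity
    linarith
  have hmono : MonotoneOn (fun s => U s + K * M / l / l * Real.exp (l * s)) (Icc 0 S) := by
    refine monotoneOn_Icc_of_hasDerivAt_nonneg
      (hU.add (by fun_prop)) (fun s hs => (hd s hs).add ((hdexp s).const_mul _)) fun s hs => ?_
    have h1 := hG s (Ioo_subset_Icc_self hs)
    have h3 : K * M / l / l * (Real.exp (l * s) * l) = K * M / l * Real.exp (l * s) := by
      field_simp
    rw [h3]; linarith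
  have h1 := hmono ⟨le_rfl, hS⟩ hs₀ hs₀.1
  simp only at h1
  have h2 : U s₀ = -(M * Real.exp (l * s₀)) := by
    rw [hM, neg_mul, neg_neg, mul_assoc, ← Real.exp_add, neg_add_cancel, Real.exp_zero, mul_one]
  have h3 : 0 ≤ K * M / l / l * Real.exp (l * 0) := by positivity
  have h4 : K * M / l / l < M := by
    rw [div_div, div_lt_iff₀ (by positivity)]
    have h6 : K < l * l := by rw [hl]; nlinarith
    have h7 := mul_lt_mul_of_pos_right h6 hM0
    linarith
  have h5 := mul_lt_mul_of_pos_right h4 (Real.exp_pos (l * s₀))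
  linarith

/-- An integrated differential inequality, in which `V` need not be differentiable, is dominated
from below by a differentiable supersolution with the same data. -/
lemma exists_isSupersolution {m p S : ℝ} (hm : 0 ≤ m) (hp : 0 ≤ p) (hS : 0 ≤ S) {k U V : ℝ → ℝ}
    (hU : ContinuousOn U (Icc 0 S)) (hVc : ContinuousOn V (Icc 0 S))
    (hd : ∀ t ∈ Ioo 0 S, HasDerivAt U (V t) t) (hU0 : 0 ≤ U 0) (hV0 : 0 ≤ V 0)
    (hk : ContinuousOn k (Icc 0 S)) (hk0 : ∀ t ∈ Icc 0 S, 0 ≤ k t)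
    (hV : ∀ t ∈ Icc 0 S, V 0 + ∫ s in (0 : ℝ)..t, (s ^ (2 * m) * U s + k s * |V s| ^ p) ≤ V t) :
    ∃ U' V' : ℝ → ℝ, IsSupersolution m p S k U' V' ∧ U' 0 = U 0 ∧ V' 0 = V 0 := by
  have hH : ContinuousOn (fun s => s ^ (2 * m) * U s + k s * |V s| ^ p) (Icc 0 S) :=
    ((Real.continuous_rpow_const (by positivity)).continuousOn.mul hU).add
      (hk.mul (hVc.abs.rpow_const fun _ _ => Or.inr hp))
  have hHU : ∀ t ∈ Icc 0 S, t ^ (2 * m) * U t ≤ t ^ (2 * m) * U t + k t * |V t| ^ p :=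
    fun t ht => le_add_of_nonneg_right (mul_nonneg (hk0 t ht) (by positivity))
  have hUnn := nonneg_of_integral_le hm hU hd hU0 hV0 hH hHU hV
  obtain ⟨G, hGc, hG0, hGd, hGe⟩ := exists_primitive_Icc hS hH (V 0)
  obtain ⟨W, hWc, hW0, hWd, -⟩ := exists_primitive_Icc hS (H := G) hGc.continuousOn (U 0)
  have h0 : (0 : ℝ) ∈ Icc 0 S := ⟨le_rfl, hS⟩
  have hGV : ∀ t ∈ Icc 0 S, G t ≤ V t := fun t ht => (hGe t ht).trans_le (hV t ht)
  have hGnn : ∀ t ∈ Icc 0 S, 0 ≤ G t := by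
    have hmono : MonotoneOn G (Icc 0 S) :=
      monotoneOn_Icc_of_hasDerivAt_nonneg hGc.continuousOn hGd fun t ht => by
        have ht' := Ioo_subset_Icc_self ht
        exact (mul_nonneg (Real.rpow_nonneg ht'.1 _) (hUnn t ht')).trans (hHU t ht')
    intro t ht
    have := hmono h0 ht ht.1
    rw [hG0] at this
    linarith
  have hWnn : ∀ t ∈ Icc 0 S, 0 ≤ W t := by
    have hmono : MonotoneOn W (Icc 0 S) :=
      monotoneOn_Icc_of_hasDerivAt_nonneg hWc.continuousOn hWd fun t ht =>
        hGnn t (Ioo_subset_Icc_self ht)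
    intro t ht
    have := hmono h0 ht ht.1
    rw [hW0] at this
    linarith
  have hWU : ∀ t ∈ Icc 0 S, W t ≤ U t := by
    have hmono : MonotoneOn (fun t => U t - W t) (Icc 0 S) :=
      monotoneOn_Icc_of_hasDerivAt_nonneg (hU.sub hWc.continuousOn)
        (fun t ht => (hd t ht).sub (hWd t ht)) fun t ht =>
          sub_nonneg.2 (hGV t (Ioo_subset_Icc_self ht))
    intro t ht
    have := hmono h0 ht ht.1
    simp only [hW0, sub_self] at this
    linarith
  refine ⟨W, G, ⟨hWc.continuousOn, hGc.continuousOn, hWnn, hGnn, hWd, fun t ht =>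
    ⟨_, hGd t ht, ?_⟩⟩, hW0, hG0⟩
  have ht' := Ioo_subset_Icc_self ht
  have h1 := Real.rpow_nonneg ht'.1 (2 * m)
  have h2 := hWU t ht'
  have h3 := hk0 t ht'
  have h4 : G t ^ p ≤ |V t| ^ p :=
    Real.rpow_le_rpow (hGnn t ht') ((hGV t ht').trans (le_abs_self _)) hp
  gcongr

/-! ### The plane wave and its mass on balls -/

/-- The mass of the plane wave `e^(x₀)` on a ball. On `|x| ≤ r` one has
`|x|² - x₀² ≤ r² - x₀² ≤ 2 r (r - x₀)`, which bounds `e^(x₀)` there by a product of an exponential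
in `x₀` and Gaussians in the other coordinates. -/
lemma setIntegral_exp_coord_le {N : ℕ} (i₀ : Fin N) {r : ℝ} (hr : 0 < r) :
    ∫ x in Metric.closedBall (0 : EuclideanSpace ℝ (Fin N)) r, Real.exp (x i₀)
      ≤ 2 * Real.exp r * √(4 * Real.pi * r) ^ (N - 1) := by
  set q : Fin N → ℝ → ℝ := fun i s => if i = i₀ then (Iic r).indicator (fun s => Real.exp (s / 2)) s
    else Real.exp (-(1 / (4 * r)) * s ^ 2) with hq
  have hexpint : IntegrableOn (fun s : ℝ => Real.exp (s / 2)) (Iic r) := by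
    have := integrableOn_exp_mul_Iic (a := 1 / 2) (by norm_num) r
    simpa [div_eq_inv_mul] using this
  have hqint : ∀ i, Integrable (q i) := by
    intro i
    by_cases h : i = i₀
    · simp only [hq, h, if_true]
      exact (integrable_indicator_iff measurableSet_Iic).2 hexpint
    · simp only [hq, h, if_false]
      exact integrable_exp_neg_mul_sq (by positivity)
  have hqnn : ∀ i s, 0 ≤ q i s := by
    intro i s
    by_cases h : i = i₀
    · simp only [hq, h, if_true]
      exact indicator_nonneg (fun _ _ => (Real.exp_pos _).le) _
    · simp only [hq, h, if_false]
      positivity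
  have hprod : Integrable (fun x : EuclideanSpace ℝ (Fin N) => ∏ i, q i (x i)) := by
    have h1 : Integrable (fun x : Fin N → ℝ => ∏ i, q i (x i)) := Integrable.fintype_prod hqint
    exact ((EuclideanSpace.volume_preserving_symm_measurableEquiv_toLp
      (Fin N)).integrable_comp_emb (MeasurableEquiv.measurableEmbedding _)).2 h1
  have hprodint : ∫ x : EuclideanSpace ℝ (Fin N), ∏ i, q i (x i)
      = 2 * Real.exp (r / 2) * √(4 * Real.pi * r) ^ (N - 1) := by
    have h1 : ∫ x : EuclideanSpace ℝ (Fin N), ∏ i, q i (x i)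
        = ∫ x : Fin N → ℝ, ∏ i, q i (x i) :=
      (EuclideanSpace.volume_preserving_symm_measurableEquiv_toLp (Fin N)).integral_comp
        (MeasurableEquiv.measurableEmbedding _) (fun x : Fin N → ℝ => ∏ i, q i (x i))
    rw [h1, integral_fintype_prod_volume_eq_prod, ← Finset.mul_prod_erase _ _ (Finset.mem_univ i₀)]
    congr 1
    · simp only [hq, if_true]
      rw [integral_indicator measurableSet_Iic]
      have := integral_exp_mul_Iic (a := 1 / 2) (by norm_num) r
      simp only [one_div, ← div_eq_inv_mul] at this
      rw [this]
      ring
    · rw [Finset.prod_congr rfl (g := fun _ => √(4 * Real.pi * r))]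
      · simp
      · intro i hi
        simp only [hq, (Finset.mem_erase.1 hi).1, if_false]
        rw [integral_gaussian]
        congr 1
        field_simp
  have hle : ∀ x ∈ Metric.closedBall (0 : EuclideanSpace ℝ (Fin N)) r,
      Real.exp (x i₀) ≤ Real.exp (r / 2) * ∏ i, q i (x i) := by
    intro x hx
    rw [mem_closedBall_zero_iff] at hx
    have hsq : ‖x‖ ^ 2 = x i₀ ^ 2 + ∑ i ∈ Finset.univ.erase i₀, x i ^ 2 := by
      rw [EuclideanSpace.real_norm_sq_eq, Finset.add_sum_erase _ (fun i => x i ^ 2)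
        (Finset.mem_univ i₀)]
    have hxr : x i₀ ≤ r := by
      have h1 : |x i₀| ≤ ‖x‖ := by simpa using PiLp.norm_apply_le x i₀
      exact (le_abs_self _).trans (h1.trans hx)
    have h2 : ∏ i ∈ Finset.univ.erase i₀, q i (x i)
        = Real.exp (-(1 / (4 * r)) * ∑ i ∈ Finset.univ.erase i₀, x i ^ 2) := by
      rw [Finset.mul_sum, Real.exp_sum]
      refine Finset.prod_congr rfl fun i hi => ?_
      simp only [hq, (Finset.mem_erase.1 hi).1, if_false]
    rw [← Finset.mul_prod_erase _ _ (Finset.mem_univ i₀), h2]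
    simp only [hq, if_true]
    rw [indicator_of_mem (mem_Iic.2 hxr), ← Real.exp_add, ← Real.exp_add]
    refine Real.exp_le_exp.2 ?_
    set Y := ∑ i ∈ Finset.univ.erase i₀, x i ^ 2
    have h3 : ‖x‖ ^ 2 ≤ r ^ 2 := by gcongr
    have h4 : 1 / (4 * r) * Y ≤ (r - x i₀) / 2 := by
      rw [one_div_mul_eq_div, div_le_iff₀ (by positivity)]
      nlinarith [sq_nonneg (r - x i₀)]
    linarith
  calc ∫ x in Metric.closedBall (0 : EuclideanSpace ℝ (Fin N)) r, Real.exp (x i₀)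
      ≤ ∫ x in Metric.closedBall (0 : EuclideanSpace ℝ (Fin N)) r,
          Real.exp (r / 2) * ∏ i, q i (x i) := by
        refine setIntegral_mono_on ?_ (hprod.const_mul _).integrableOn
          Metric.isClosed_closedBall.measurableSet hle
        exact (Continuous.continuousOn (by fun_prop)).integrableOn_compact
          (isCompact_closedBall _ _)
    _ ≤ ∫ x : EuclideanSpace ℝ (Fin N), Real.exp (r / 2) * ∏ i, q i (x i) :=
        setIntegral_le_integral (hprod.const_mul _) (Filter.Eventually.of_forall fun x =>
          mul_nonneg (Real.exp_pos _).le (Finset.prod_nonneg fun i _ => hqnn i _))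
    _ = 2 * Real.exp r * √(4 * Real.pi * r) ^ (N - 1) := by
        rw [integral_const_mul, hprodint, ← mul_assoc, mul_left_comm, ← Real.exp_add, add_halves]

/-! ### Cut-off test functions -/

/-- The plane wave `e^(x₀)` cut off outside a ball of radius larger than `r`. -/
lemma exists_cutoff_exp {N : ℕ} (i₀ : Fin N) {r : ℝ} (hr : 0 < r) :
    ∃ Ψ : EuclideanSpace ℝ (Fin N) → ℝ, ContDiff ℝ ∞ Ψ ∧ HasCompactSupport Ψ ∧
      (∀ x, 0 ≤ Ψ x) ∧ (∀ x, Ψ x ≤ Real.exp (x i₀)) ∧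
      ∀ x, ‖x‖ ≤ r → Ψ =ᶠ[nhds x] fun x => Real.exp (x i₀) := by
  let χ : ContDiffBump (0 : EuclideanSpace ℝ (Fin N)) := ⟨r + 1, r + 2, by positivity, by linarith⟩
  have hexp : ContDiff ℝ ∞ (fun x : EuclideanSpace ℝ (Fin N) => Real.exp (x i₀)) := by fun_prop
  refine ⟨fun x => χ x * Real.exp (x i₀), χ.contDiff.mul hexp, χ.hasCompactSupport.mul_right,
    fun x => mul_nonneg χ.nonneg (Real.exp_pos _).le,
    fun x => mul_le_of_le_one_left (Real.exp_pos _).le χ.le_one, fun x hx => ?_⟩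
  have hx' : x ∈ Metric.ball (0 : EuclideanSpace ℝ (Fin N)) (r + 1) := by
    rw [mem_ball_zero_iff]; linarith
  filter_upwards [Metric.isOpen_ball.mem_nhds hx'] with y hy
  rw [χ.one_of_mem_closedBall (Metric.ball_subset_closedBall hy), one_mul]

lemma exists_time_cutoff {S : ℝ} (hS : 0 < S) {T : EReal} (hST : (S : EReal) < T) :
    ∃ η : ℝ → ℝ, ContDiff ℝ ∞ η ∧ HasCompactSupport η ∧ (∀ s ∈ tsupport η, (s : EReal) < T) ∧
      ∀ s ∈ Icc 0 S, η =ᶠ[nhds s] fun _ => 1 := by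
  obtain ⟨S', hSS', hS'T⟩ := EReal.lt_iff_exists_real_btwn.1 hST
  have hlt : S < S' := EReal.coe_lt_coe_iff.1 hSS'
  let χ : ContDiffBump (0 : ℝ) := ⟨(S + S') / 2, S', by linarith, by linarith⟩
  refine ⟨χ, χ.contDiff, χ.hasCompactSupport, fun s hs => ?_, fun s hs => ?_⟩
  · rw [χ.tsupport_eq, mem_closedBall_zero_iff] at hs
    exact lt_of_le_of_lt (EReal.coe_le_coe_iff.2 ((le_abs_self s).trans hs)) hS'T
  · have hs' : s ∈ Metric.ball (0 : ℝ) ((S + S') / 2) := by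
      rw [mem_ball_zero_iff, Real.norm_of_nonneg hs.1]; linarith [hs.2]
    filter_upwards [Metric.isOpen_ball.mem_nhds hs'] with y hy
    exact χ.one_of_mem_closedBall (Metric.ball_subset_closedBall hy)

lemma isTestFunction_mul {N : ℕ} {T : EReal} {Ψ : EuclideanSpace ℝ (Fin N) → ℝ} {η : ℝ → ℝ}
    (hΨ : ContDiff ℝ ∞ Ψ) (hΨc : HasCompactSupport Ψ) (hη : ContDiff ℝ ∞ η)
    (hηc : HasCompactSupport η) (hηT : ∀ s ∈ tsupport η, (s : EReal) < T) :
    IsTestFunction T (fun z : EuclideanSpace ℝ (Fin N) × ℝ => Ψ z.1 * η z.2) where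
  smooth := (hΨ.comp contDiff_fst).mul (hη.comp contDiff_snd)
  compact_support := by
    refine HasCompactSupport.intro (hΨc.isCompact.prod hηc.isCompact) fun z hz => ?_
    rw [mem_prod, not_and_or] at hz
    rcases hz with hz | hz <;> simp [image_eq_zero_of_notMem_tsupport hz]
  support_lt := fun z hz => by
    refine hηT z.2 ?_
    have h : tsupport (fun z : EuclideanSpace ℝ (Fin N) × ℝ => Ψ z.1 * η z.2)
        ⊆ Prod.snd ⁻¹' tsupport η := by
      refine closure_minimal (fun z hz => ?_) ((isClosed_tsupport η).preimage continuous_snd)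
      exact subset_tsupport _ (right_ne_zero_of_mul hz)
    exact h hz

/-! ### Pairing `L²` functions with test functions -/

section Pairing

variable {N : ℕ} {Ψ : EuclideanSpace ℝ (Fin N) → ℝ}

lemma L2.integrable_mul_of_hasCompactSupport (u : L2 N ℝ) (hΨ : Continuous Ψ)
    (hΨc : HasCompactSupport Ψ) : Integrable (fun x => u x * Ψ x) :=
  MemLp.integrable_mul (p := 2) (q := 2) (Lp.memLp u) (hΨ.memLp_of_hasCompactSupport hΨc)

lemma L2.exists_clm_eq_integral_mul (hΨ : Continuous Ψ) (hΨc : HasCompactSupport Ψ) :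
    ∃ L : L2 N ℝ →L[ℝ] ℝ, ∀ u : L2 N ℝ, L u = ∫ x, u x * Ψ x := by
  have h : MemLp Ψ 2 (volume : Measure (EuclideanSpace ℝ (Fin N))) :=
    hΨ.memLp_of_hasCompactSupport hΨc
  refine ⟨innerSL ℝ (h.toLp Ψ), fun u => ?_⟩
  rw [innerSL_apply_apply, L2.inner_def]
  refine integral_congr_ae ?_
  filter_upwards [h.coeFn_toLp] with x hx
  rw [hx]
  rfl

/-- Integration by parts against a function which agrees with the plane wave near the ball that
carries `u`: there it is an eigenfunction of the Laplacian. -/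
lemma IsWeakGradient.integral_inner_gradient {u : L2 N ℝ} {w : L2 N (EuclideanSpace ℝ (Fin N))}
    (h : IsWeakGradient u w) (i₀ : Fin N) {r : ℝ} (hu : ∀ᵐ x, r < ‖x‖ → u x = 0)
    (hΨ : ContDiff ℝ ∞ Ψ) (hΨc : HasCompactSupport Ψ)
    (hΨe : ∀ x, ‖x‖ ≤ r → Ψ =ᶠ[nhds x] fun x => Real.exp (x i₀)) :
    ∫ x, inner ℝ (w x) (gradient Ψ x) = -∫ x, u x * Ψ x := by
  let b := EuclideanSpace.basisFun (Fin N) ℝ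
  have hd : ∀ i, ContDiff ℝ ∞ (fun x => fderiv ℝ Ψ x (b i)) := fun i =>
    (hΨ.fderiv_right (m := ∞) (by simp)).clm_apply contDiff_const
  have hdc : ∀ i, HasCompactSupport (fun x => fderiv ℝ Ψ x (b i)) := fun i =>
    hΨc.fderiv_apply ℝ (b i)
  have hd2 : ∀ i, ContDiff ℝ ∞ (fun x => fderiv ℝ (fun x => fderiv ℝ Ψ x (b i)) x (b i)) :=
    fun i => ((hd i).fderiv_right (m := ∞) (by simp)).clm_apply contDiff_const
  have hd2c : ∀ i, HasCompactSupport (fun x => fderiv ℝ (fun x => fderiv ℝ Ψ x (b i)) x (b i)) :=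
    fun i => (hdc i).fderiv_apply ℝ (b i)
  have hexp : ∀ (x e : EuclideanSpace ℝ (Fin N)),
      fderiv ℝ (fun x : EuclideanSpace ℝ (Fin N) => Real.exp (x i₀)) x e
        = Real.exp (x i₀) * e i₀ := by
    intro x e
    have h1 : HasFDerivAt (fun x : EuclideanSpace ℝ (Fin N) => x i₀)
        (EuclideanSpace.proj i₀ : EuclideanSpace ℝ (Fin N) →L[ℝ] ℝ) x :=
      (EuclideanSpace.proj i₀ : EuclideanSpace ℝ (Fin N) →L[ℝ] ℝ).hasFDerivAt
    rw [h1.exp.fderiv]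
    simp
  have hlap : ∀ x, ‖x‖ ≤ r →
      ∑ i, fderiv ℝ (fun x => fderiv ℝ Ψ x (b i)) x (b i) = Ψ x := by
    intro x hx
    have h1 : ∀ i, fderiv ℝ (fun x => fderiv ℝ Ψ x (b i)) x (b i)
        = Real.exp (x i₀) * (b i i₀ * b i i₀) := by
      intro i
      have h2 : (fun x => fderiv ℝ Ψ x (b i)) =ᶠ[nhds x]
          fun x => Real.exp (x i₀) * b i i₀ := by
        filter_upwards [(hΨe x hx).fderiv (𝕜 := ℝ)] with y hy
        rw [hy, hexp]
      rw [h2.fderiv_eq, fderiv_mul_const (by fun_prop)]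
      simp only [_root_.smul_apply, hexp, smul_eq_mul]
      ring
    rw [(hΨe x hx).eq_of_nhds, Finset.sum_congr rfl fun i _ => h1 i, ← Finset.mul_sum]
    simp [b]
  have hinner : ∀ x, inner ℝ (w x) (gradient Ψ x)
      = ∑ i, inner ℝ (w x) (b i) * fderiv ℝ Ψ x (b i) := by
    intro x
    rw [← b.sum_inner_mul_inner]
    refine Finset.sum_congr rfl fun i _ => ?_
    rw [real_inner_comm (gradient Ψ x), gradient, InnerProductSpace.toDual_symm_apply]
  have hint : ∀ i, Integrable (fun x => inner ℝ (w x) (b i) * fderiv ℝ Ψ x (b i)) := fun i =>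
    MemLp.integrable_mul (p := 2) (q := 2) ((Lp.memLp w).inner_const (b i))
      ((hd i).continuous.memLp_of_hasCompactSupport (hdc i))
  simp_rw [hinner]
  rw [integral_finsetSum _ fun i _ => hint i]
  have h3 : ∀ i, ∫ x, inner ℝ (w x) (b i) * fderiv ℝ Ψ x (b i)
      = -∫ x, u x * fderiv ℝ (fun x => fderiv ℝ Ψ x (b i)) x (b i) := fun i => by
    rw [h _ (hd i) (hdc i) (b i), neg_neg]
  rw [Finset.sum_congr rfl fun i _ => h3 i, Finset.sum_neg_distrib, ← integral_finsetSum _ fun i _ =>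
    L2.integrable_mul_of_hasCompactSupport u (hd2 i).continuous (hd2c i)]
  congr 1
  refine integral_congr_ae ?_
  filter_upwards [hu] with x hx
  rw [← Finset.mul_sum]
  rcases lt_or_ge r ‖x‖ with hr | hr
  · rw [hx hr, zero_mul, zero_mul]
  · rw [hlap x hr]

/-- Hölder's inequality for the weight `Ψ` on the ball that carries `v`. -/
lemma abs_integral_mul_rpow_le {p : ℝ} (hp : 1 < p) {r : ℝ} {v : L2 N ℝ}
    (hv : ∀ᵐ x, r < ‖x‖ → v x = 0) (hΨ : Continuous Ψ) (hΨc : HasCompactSupport Ψ)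
    (hΨ0 : ∀ x, 0 ≤ Ψ x) (hint : Integrable (fun x => |v x| ^ p * Ψ x)) :
    |∫ x, v x * Ψ x| ^ p
      ≤ (∫ x, |v x| ^ p * Ψ x) * (∫ x in Metric.closedBall 0 r, Ψ x) ^ (p - 1) := by
  have hp0 : 0 < p := by linarith
  have hpq : p.HolderConjugate (p / (p - 1)) := Real.HolderConjugate.conjExponent hp
  set q := p / (p - 1) with hq
  have hq0 : 0 < q := hpq.symm.pos
  set B := Metric.closedBall (0 : EuclideanSpace ℝ (Fin N)) r
  have hvm : AEStronglyMeasurable (v : EuclideanSpace ℝ (Fin N) → ℝ) volume :=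
    (Lp.memLp v).aestronglyMeasurable
  have hroot : ∀ {s : ℝ}, 0 < s → Continuous fun x => Ψ x ^ (1 / s) := fun hs =>
    hΨ.rpow_const fun _ => Or.inr (by positivity)
  have hpow : ∀ {s : ℝ}, 0 < s → ∀ x, (Ψ x ^ (1 / s)) ^ s = Ψ x := fun {s} hs x => by
    rw [← Real.rpow_mul (hΨ0 x), one_div_mul_cancel hs.ne', Real.rpow_one]
  have hfp : ∀ x, (|v x| * Ψ x ^ (1 / p)) ^ p = |v x| ^ p * Ψ x := fun x => by
    rw [Real.mul_rpow (abs_nonneg _) (Real.rpow_nonneg (hΨ0 x) _), hpow hp0]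
  have hf : MemLp (fun x => |v x| * Ψ x ^ (1 / p)) (ENNReal.ofReal p) (volume.restrict B) := by
    refine MemLp.restrict B ?_
    have hm : AEStronglyMeasurable (fun x => |v x| * Ψ x ^ (1 / p)) volume :=
      hvm.norm.mul (hroot hp0).aestronglyMeasurable
    rw [← integrable_norm_rpow_iff hm (by simpa using hp0) ENNReal.ofReal_ne_top,
      ENNReal.toReal_ofReal hp0.le]
    refine hint.congr (Filter.Eventually.of_forall fun x => ?_)
    have : 0 ≤ |v x| * Ψ x ^ (1 / p) := mul_nonneg (abs_nonneg _) (Real.rpow_nonneg (hΨ0 x) _)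
    simp only [norm_mul, Real.norm_eq_abs, abs_abs,
      abs_of_nonneg (Real.rpow_nonneg (hΨ0 x) (1 / p))]
    exact (hfp x).symm
  have hg : MemLp (fun x => Ψ x ^ (1 / q)) (ENNReal.ofReal q) (volume.restrict B) := by
    refine MemLp.restrict B ((hroot hq0).memLp_of_hasCompactSupport ?_)
    exact hΨc.comp_left (g := fun y : ℝ => y ^ (1 / q)) (Real.zero_rpow (by positivity))
  have hholder := integral_mul_le_Lp_mul_Lq_of_nonneg hpq
    (Filter.Eventually.of_forall fun x => mul_nonneg (abs_nonneg (v x))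
      (Real.rpow_nonneg (hΨ0 x) (1 / p)))
    (Filter.Eventually.of_forall fun x => Real.rpow_nonneg (hΨ0 x) (1 / q)) hf hg
  simp only [hfp, hpow hq0] at hholder
  have hsum : ∀ x, |v x| * Ψ x ^ (1 / p) * Ψ x ^ (1 / q) = |v x| * Ψ x := fun x => by
    rw [mul_assoc, ← Real.rpow_add_of_nonneg (hΨ0 x) (by positivity) (by positivity), one_div,
      one_div, hpq.inv_add_inv_eq_one, Real.rpow_one]
  simp only [hsum] at hholder
  have h1 : |∫ x, v x * Ψ x| ≤ ∫ x in B, |v x| * Ψ x := by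
    have h2 : ∫ x in B, |v x| * Ψ x = ∫ x, |v x| * Ψ x := by
      refine setIntegral_eq_integral_of_ae_compl_eq_zero ?_
      filter_upwards [hv] with x hx hxB
      rw [mem_closedBall_zero_iff, not_le] at hxB
      rw [hx hxB, abs_zero, zero_mul]
    rw [h2]
    refine (abs_integral_le_integral_abs).trans_eq (integral_congr_ae
      (Filter.Eventually.of_forall fun x => ?_))
    simp only [abs_mul, abs_of_nonneg (hΨ0 x)]
  have hIB : 0 ≤ ∫ x in B, |v x| ^ p * Ψ x :=
    integral_nonneg fun x => mul_nonneg (by positivity) (hΨ0 x)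
  have hJ : 0 ≤ ∫ x in B, Ψ x := integral_nonneg fun x => hΨ0 x
  have h3 : ∫ x in B, |v x| ^ p * Ψ x ≤ ∫ x, |v x| ^ p * Ψ x :=
    setIntegral_le_integral hint (Filter.Eventually.of_forall fun x =>
      mul_nonneg (by positivity) (hΨ0 x))
  have h4 := Real.rpow_le_rpow (abs_nonneg _) (h1.trans hholder) hp0.le
  rw [Real.mul_rpow (by positivity) (by positivity), ← Real.rpow_mul hIB, ← Real.rpow_mul hJ,
    one_div_mul_cancel hp0.ne', Real.rpow_one] at h4
  have h5 : 1 / q * p = p - 1 := by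
    rw [hq]; field_simp
  rw [h5] at h4
  exact h4.trans (mul_le_mul_of_nonneg_right h3 (Real.rpow_nonneg hJ _))

end Pairing

/-- The time derivative of a function supported in the light cone is supported there too. -/
lemma SupportedInLightCone.ae_deriv_eq_zero {N : ℕ} {m R : ℝ} {T : EReal} {u : ℝ → L2 N ℝ}
    (h : SupportedInLightCone m R T u) (hm : 0 ≤ m) {t : ℝ} (ht0 : 0 < t) (ht : t ∈ timeInterval T)
    {v : L2 N ℝ} (hd : HasDerivWithinAt u v (timeInterval T) t) :
    ∀ᵐ x, xi m t + R < ‖x‖ → v x = 0 := by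
  set A : Set (EuclideanSpace ℝ (Fin N)) := {x | xi m t + R < ‖x‖} with hA
  have hAm : MeasurableSet A := measurableSet_lt measurable_const measurable_norm
  let P := LpToLpRestrictCLM (EuclideanSpace ℝ (Fin N)) ℝ ℝ volume 2 A
  have hP : ∀ g : L2 N ℝ, P g = 0 ↔ ∀ᵐ x, xi m t + R < ‖x‖ → g x = 0 := by
    intro g
    have h1 := LpToLpRestrictCLM_coeFn (F := ℝ) ℝ A g
    change _ ↔ ∀ᵐ x, x ∈ A → g x = 0
    rw [← ae_restrict_iff' hAm, Lp.eq_zero_iff_ae_eq_zero]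
    exact ⟨fun h2 => h1.symm.trans h2, fun h2 => h1.trans h2⟩
  have hsub : Icc 0 t ⊆ timeInterval T := fun s hs =>
    ⟨hs.1, lt_of_le_of_lt (EReal.coe_le_coe_iff.2 hs.2) ht.2⟩
  have hPu : ∀ s ∈ Icc 0 t, P (u s) = 0 := by
    intro s hs
    rw [hP]
    filter_upwards [h s (hsub hs)] with x hx hxt
    exact hx (lt_of_le_of_lt (by gcongr; exact xi_mono hm hs.1 hs.2) hxt)
  have h1 : HasDerivWithinAt (fun s => P (u s)) (P v) (Icc 0 t) t :=
    P.hasFDerivAt.comp_hasDerivWithinAt t (hd.mono hsub)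
  have h2 : HasDerivWithinAt (fun s => P (u s)) 0 (Icc 0 t) t :=
    (hasDerivWithinAt_const t (Icc 0 t) 0).congr hPu (hPu t ⟨ht0.le, le_rfl⟩)
  rw [← hP]
  exact (uniqueDiffOn_Icc ht0 t ⟨ht0.le, le_rfl⟩).eq_deriv _ h1 h2

/-! ### From energy solutions to differential inequalities -/

/-- The mass of the plane wave on the light cone at time `t`. -/
lemma exists_setIntegral_exp_le {N : ℕ} (i₀ : Fin N) {m R : ℝ} (hm : 0 ≤ m) (hR : 0 < R) :
    ∃ M > (0 : ℝ), ∀ t ≥ (0 : ℝ),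
      ∫ x in Metric.closedBall (0 : EuclideanSpace ℝ (Fin N)) (xi m t + R), Real.exp (x i₀)
        ≤ M * ((1 + t) ^ ((m + 1) * ((N : ℝ) - 1) / 2) * Real.exp (xi m t)) := by
  refine ⟨2 * Real.exp R * √(4 * Real.pi * (R + 1)) ^ (N - 1), by positivity, fun t ht => ?_⟩
  have hN : 1 ≤ N := Nat.one_le_of_lt i₀.2
  have hr : 0 < xi m t + R := add_pos_of_nonneg_of_pos (xi_nonneg hm ht) hR
  refine (setIntegral_exp_coord_le i₀ hr).trans ?_
  have h1 : xi m t + R ≤ (R + 1) * (1 + t) ^ (m + 1) := by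
    have h2 : xi m t ≤ (1 + t) ^ (m + 1) := by
      unfold xi
      rw [div_le_iff₀ (by positivity)]
      have h3 : t ^ (m + 1) ≤ (1 + t) ^ (m + 1) := by gcongr; linarith
      have h4 : 0 ≤ (1 + t) ^ (m + 1) := by positivity
      nlinarith
    have h3 : 1 ≤ (1 + t) ^ (m + 1) := Real.one_le_rpow (by linarith) (by positivity)
    nlinarith
  have h2 : √(4 * Real.pi * (xi m t + R)) ^ (N - 1)
      ≤ √(4 * Real.pi * (R + 1)) ^ (N - 1) * (1 + t) ^ ((m + 1) * ((N : ℝ) - 1) / 2) := by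
    have h3 : √(4 * Real.pi * (xi m t + R))
        ≤ √(4 * Real.pi * (R + 1)) * √((1 + t) ^ (m + 1)) := by
      rw [← Real.sqrt_mul (by positivity)]
      refine Real.sqrt_le_sqrt ?_
      rw [mul_assoc (4 * Real.pi)]
      gcongr
    refine (pow_le_pow_left₀ (by positivity) h3 _).trans_eq ?_
    rw [mul_pow, Real.sqrt_eq_rpow ((1 + t) ^ (m + 1)), ← Real.rpow_natCast (((1 + t) ^ (m + 1)) ^ _),
      ← Real.rpow_mul (by positivity), ← Real.rpow_mul (by positivity), Nat.cast_sub hN]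
    congr 2
    push_cast
    ring
  calc _ ≤ 2 * Real.exp (xi m t + R) * (√(4 * Real.pi * (R + 1)) ^ (N - 1)
        * (1 + t) ^ ((m + 1) * ((N : ℝ) - 1) / 2)) := by gcongr
    _ = _ := by rw [Real.exp_add]; ring

/-- The reduction to differential inequalities: `U = ∫ u e^(x₀)` and `V = ∫ u_t e^(x₀)`, evaluated
by means of a cut-off of the plane wave beyond the light cone. -/
theorem exists_isSupersolution_of_isEnergySolution {N : ℕ} (i₀ : Fin N) {m p R : ℝ} (hm : 0 ≤ m)
    (hp : 1 < p) (hR : 0 < R) :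
    ∃ κ > (0 : ℝ), ∀ (f g : EuclideanSpace ℝ (Fin N) → ℝ),
      (∀ x, 0 ≤ f x) → (∀ x, 0 ≤ g x) → tsupport f ⊆ Metric.closedBall 0 R →
      tsupport g ⊆ Metric.closedBall 0 R → ∀ ε > (0 : ℝ), ∀ (T : EReal) (u : ℝ → L2 N ℝ),
      IsEnergySolution N m p ε f g T u → SupportedInLightCone m R T u →
      ∀ S > (0 : ℝ), (S : EReal) < T → ∃ U V : ℝ → ℝ,
        IsSupersolution m p S (fun t => κ * (1 + t) ^ (-((m + 1) * ((N : ℝ) - 1) * (p - 1) / 2)) *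
          Real.exp (-((p - 1) * xi m t))) U V ∧
        U 0 = ε * ∫ x, f x * Real.exp (x i₀) ∧ V 0 = ε * ∫ x, g x * Real.exp (x i₀) := by
  obtain ⟨M, hM, hmass⟩ := exists_setIntegral_exp_le i₀ hm hR
  refine ⟨M ^ (-(p - 1)), by positivity, ?_⟩
  intro f g hf hg hfs hgs ε hε T u ⟨v, w, h⟩ hcone S hS hST
  have hp1 : 0 < p - 1 := by linarith
  have hIcc : Icc 0 S ⊆ timeInterval T := fun s hs =>
    ⟨hs.1, lt_of_le_of_lt (EReal.coe_le_coe_iff.2 hs.2) hST⟩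
  have h00 : (0 : ℝ) ∈ Icc 0 S := ⟨le_rfl, hS.le⟩
  set r : ℝ := xi m S + R with hr
  have hr0 : 0 < r := add_pos_of_nonneg_of_pos (xi_nonneg hm hS.le) hR
  have hRr : R ≤ r := le_add_of_nonneg_left (xi_nonneg hm hS.le)
  have hrs : ∀ s ∈ Icc 0 S, xi m s + R ≤ r := fun s hs => by
    rw [hr]; gcongr; exact xi_mono hm hs.1 hs.2
  obtain ⟨Ψ, hΨ, hΨc, hΨ0, hΨle, hΨe⟩ := exists_cutoff_exp i₀ hr0
  obtain ⟨η, hη, hηc, hηT, hη1⟩ := exists_time_cutoff hS hST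
  have hη1' : ∀ s ∈ Icc 0 S, η s = 1 := fun s hs => (hη1 s hs).eq_of_nhds
  have hΦ := isTestFunction_mul hΨ hΨc hη hηc hηT
  obtain ⟨L, hL⟩ := L2.exists_clm_eq_integral_mul hΨ.continuous hΨc
  -- the values at time `0`
  have hinit : ∀ (f : EuclideanSpace ℝ (Fin N) → ℝ) (u : L2 N ℝ),
      tsupport f ⊆ Metric.closedBall 0 R → (∀ᵐ x, u x = ε * f x) →
      L u = ε * ∫ x, f x * Real.exp (x i₀) := by
    intro f u hfs hu
    rw [hL, ← integral_const_mul]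
    refine integral_congr_ae ?_
    filter_upwards [hu] with x hx
    rw [hx, mul_assoc]
    congr 1
    by_cases hfx : f x = 0
    · rw [hfx, zero_mul, zero_mul]
    · have h1 := hfs (subset_tsupport f hfx)
      rw [mem_closedBall_zero_iff] at h1
      rw [(hΨe x (h1.trans hRr)).eq_of_nhds]
  have hU0 := hinit f (u 0) hfs h.initial_u
  have hV0 := hinit g (v 0) hgs h.initial_v
  have hpos : ∀ f : EuclideanSpace ℝ (Fin N) → ℝ, (∀ x, 0 ≤ f x) →
      0 ≤ ε * ∫ x, f x * Real.exp (x i₀) := fun f hf =>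
    mul_nonneg hε.le (integral_nonneg fun x => mul_nonneg (hf x) (Real.exp_pos _).le)
  rw [← hU0, ← hV0]
  set β := (m + 1) * ((N : ℝ) - 1) * (p - 1) / 2 with hβ
  set k : ℝ → ℝ := fun t => M ^ (-(p - 1)) * (1 + t) ^ (-β) * Real.exp (-((p - 1) * xi m t))
    with hk
  have hLu : ContinuousOn (fun t => L (u t)) (Icc 0 S) :=
    L.continuous.comp_continuousOn (h.continuous_u.mono hIcc)
  have hLv : ContinuousOn (fun t => L (v t)) (Icc 0 S) :=
    L.continuous.comp_continuousOn (h.continuous_v.mono hIcc)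
  have hkc : ContinuousOn k (Icc 0 S) := by
    have h1 : ContinuousOn (fun t : ℝ => (1 + t) ^ (-β)) (Icc 0 S) :=
      (by fun_prop : ContinuousOn (fun t : ℝ => 1 + t) (Icc 0 S)).rpow_const
        fun t ht => Or.inl (by have := ht.1; positivity)
    have h2 := (continuous_xi hm).continuousOn (s := Icc 0 S)
    exact (continuousOn_const.mul h1).mul (continuousOn_const.mul h2).neg.rexp
  have hk0 : ∀ t ∈ Icc 0 S, 0 ≤ k t := fun t ht => by
    have := ht.1
    positivity
  -- the nonlinear term dominates `k |V|^p`
  have hNL : ∀ s ∈ Ioc 0 S, Integrable (fun x => |v s x| ^ p * Ψ x) →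
      k s * |L (v s)| ^ p ≤ ∫ x, |v s x| ^ p * Ψ x := by
    intro s hs hint
    have hs' : s ∈ Icc 0 S := Ioc_subset_Icc_self hs
    have hs0 : 0 < 1 + s := by linarith [hs.1]
    have h1 := abs_integral_mul_rpow_le hp
      (hcone.ae_deriv_eq_zero hm hs.1 (hIcc hs') (h.deriv_u s (hIcc hs')))
      hΨ.continuous hΨc hΨ0 hint
    rw [← hL] at h1
    have h2 : ∫ x in Metric.closedBall 0 (xi m s + R), Ψ x
        ≤ M * ((1 + s) ^ ((m + 1) * ((N : ℝ) - 1) / 2) * Real.exp (xi m s)) := by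
      refine le_trans (integral_mono ?_ ?_ hΨle) (hmass s hs.1.le)
      · exact (hΨ.continuous.integrable_of_hasCompactSupport hΨc).integrableOn
      · exact (Continuous.continuousOn (by fun_prop)).integrableOn_compact
          (isCompact_closedBall _ _)
    have h3 : k s * (M * ((1 + s) ^ ((m + 1) * ((N : ℝ) - 1) / 2) * Real.exp (xi m s))) ^ (p - 1)
        = 1 := by
      simp only [hk]
      rw [Real.mul_rpow hM.le (by positivity), Real.mul_rpow (by positivity) (by positivity),
        ← Real.rpow_mul hs0.le, ← Real.exp_mul, Real.rpow_neg hM.le, Real.rpow_neg hs0.le,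
        Real.exp_neg, mul_comm (xi m s),
        show (m + 1) * ((N : ℝ) - 1) / 2 * (p - 1) = β by rw [hβ]; ring]
      have e1 : M ^ (p - 1) ≠ 0 := by positivity
      have e2 : (1 + s) ^ β ≠ 0 := by positivity
      field_simp
    have hI : 0 ≤ ∫ x, |v s x| ^ p * Ψ x :=
      integral_nonneg fun x => mul_nonneg (by positivity) (hΨ0 x)
    have hJ : 0 ≤ ∫ x in Metric.closedBall 0 (xi m s + R), Ψ x := integral_nonneg fun x => hΨ0 x
    calc k s * |L (v s)| ^ p
        ≤ k s * ((∫ x, |v s x| ^ p * Ψ x) *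
          (M * ((1 + s) ^ ((m + 1) * ((N : ℝ) - 1) / 2) * Real.exp (xi m s))) ^ (p - 1)) := by
          refine mul_le_mul_of_nonneg_left (h1.trans ?_) (hk0 s hs')
          gcongr
      _ = (∫ x, |v s x| ^ p * Ψ x) * (k s *
          (M * ((1 + s) ^ ((m + 1) * ((N : ℝ) - 1) / 2) * Real.exp (xi m s))) ^ (p - 1)) := by
          ring
      _ = _ := by rw [h3, mul_one]
  refine exists_isSupersolution hm (by linarith) hS.le hLu hLv (fun t ht => ?_)
    (hU0 ▸ hpos f hf) (hV0 ▸ hpos g hg) hkc hk0 fun t ht => ?_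
  · have ht' := Ioo_subset_Icc_self ht
    exact L.hasFDerivAt.comp_hasDerivAt t
      (((h.deriv_u t (hIcc ht')).mono hIcc).hasDerivAt (Icc_mem_nhds ht.1 ht.2))
  · have hsub : Icc 0 t ⊆ Icc 0 S := Icc_subset_Icc_right ht.2
    have hweak := h.weak_form _ hΦ t (hIcc ht)
    obtain ⟨hae, hnl⟩ := h.nonlinear_integrable _ hΦ t (hIcc ht)
    simp only [hη1' t ht, hη1' 0 h00, mul_one, ← hL] at hweak
    have e1 : ∫ s in (0 : ℝ)..t, ∫ x, v s x * deriv (fun τ => Ψ x * η τ) s = 0 := by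
      rw [intervalIntegral.integral_congr (g := fun _ => 0), intervalIntegral.integral_zero]
      intro s hs
      rw [uIcc_of_le ht.1] at hs
      have h1 : ∀ x, deriv (fun τ => Ψ x * η τ) s = 0 := fun x => by
        rw [deriv_const_mul_field, (hη1 s (hsub hs)).deriv_eq, deriv_const, mul_zero]
      simp [h1]
    have e2 : ∫ s in (0 : ℝ)..t, s ^ (2 * m) *
        ∫ x, inner ℝ (w s x) (gradient (fun y => Ψ y * η s) x)
        = -∫ s in (0 : ℝ)..t, s ^ (2 * m) * L (u s) := by
      rw [← intervalIntegral.integral_neg]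
      refine intervalIntegral.integral_congr fun s hs => ?_
      rw [uIcc_of_le ht.1] at hs
      have hs' := hsub hs
      simp only [hη1' s hs', mul_one]
      rw [(h.weak_gradient s (hIcc hs')).integral_inner_gradient i₀ (r := r) ?_ hΨ hΨc hΨe, hL,
        mul_neg]
      filter_upwards [hcone s (hIcc hs')] with x hx hxr
      exact hx (lt_of_le_of_lt (hrs s hs') hxr)
    have e3 : ∫ s in (0 : ℝ)..t, ∫ x, |v s x| ^ p * (Ψ x * η s)
        = ∫ s in (0 : ℝ)..t, ∫ x, |v s x| ^ p * Ψ x := by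
      refine intervalIntegral.integral_congr fun s hs => ?_
      rw [uIcc_of_le ht.1] at hs
      simp only [hη1' s (hsub hs), mul_one]
    have hnl' : IntervalIntegrable (fun s => ∫ x, |v s x| ^ p * Ψ x) volume 0 t := by
      refine hnl.congr fun s hs => ?_
      rw [uIoc_of_le ht.1] at hs
      simp only [hη1' s (hsub (Ioc_subset_Icc_self hs)), mul_one, abs_of_nonneg (hΨ0 _)]
    rw [e1, e2, e3] at hweak
    have i1 : IntervalIntegrable (fun s => s ^ (2 * m) * L (u s)) volume 0 t := by
      refine ContinuousOn.intervalIntegrable ?_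
      rw [uIcc_of_le ht.1]
      exact (Real.continuous_rpow_const (by positivity)).continuousOn.mul (hLu.mono hsub)
    have i2 : IntervalIntegrable (fun s => k s * |L (v s)| ^ p) volume 0 t := by
      refine ContinuousOn.intervalIntegrable ?_
      rw [uIcc_of_le ht.1]
      exact (hkc.mono hsub).mul ((hLv.mono hsub).abs.rpow_const fun _ _ => Or.inr (by linarith))
    have hle : ∫ s in (0 : ℝ)..t, k s * |L (v s)| ^ p
        ≤ ∫ s in (0 : ℝ)..t, ∫ x, |v s x| ^ p * Ψ x := by
      rw [intervalIntegral.integral_of_le ht.1, intervalIntegral.integral_of_le ht.1]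
      refine integral_mono_ae i2.1 hnl'.1 ?_
      filter_upwards [hae, ae_restrict_mem measurableSet_Ioc] with s hs hs'
      have hs'' := hsub (Ioc_subset_Icc_self hs')
      simp only [hη1' s hs'', mul_one, abs_of_nonneg (hΨ0 _)] at hs
      exact hNL s ⟨hs'.1, hs''.2⟩ hs
    rw [intervalIntegral.integral_add i1 i2]
    linarith

lemma integral_mul_exp_pos {N : ℕ} (i₀ : Fin N) {R : ℝ} {f : EuclideanSpace ℝ (Fin N) → ℝ}
    (hf : Continuous f) (hf0 : ∀ x, 0 ≤ f x) (hfs : tsupport f ⊆ Metric.closedBall 0 R)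
    (hne : f ≠ 0) : 0 < ∫ x, f x * Real.exp (x i₀) := by
  obtain ⟨x, hx⟩ := Function.ne_iff.1 hne
  have hfc : HasCompactSupport f :=
    (isCompact_closedBall (0 : EuclideanSpace ℝ (Fin N)) R).of_isClosed_subset
      (isClosed_tsupport f) hfs
  refine Continuous.integral_pos_of_hasCompactSupport_nonneg_nonzero
    (hf.mul (by fun_prop)) hfc.mul_right
    (fun x => mul_nonneg (hf0 x) (Real.exp_pos _).le) (x := x) ?_
  exact mul_ne_zero hx (Real.exp_pos _).ne'

lemma EReal.le_coe_of_forall_pos_lt {T : EReal} {B : ℝ} (hB : 0 ≤ B)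
    (h : ∀ S > (0 : ℝ), (S : EReal) < T → S ≤ B) : T ≤ (B : EReal) := by
  by_contra! hlt
  obtain ⟨S, hBS, hST⟩ := EReal.lt_iff_exists_real_btwn.1 hlt
  have h1 : B < S := EReal.coe_lt_coe_iff.1 hBS
  exact absurd (h S (hB.trans_lt h1) hST) (not_le.2 h1)

theorem mainTheorem2 (N : ℕ) (hN : 1 ≤ N) (m p R : ℝ) (hm : 0 ≤ m) (hp : 1 < p) (hR : 0 < R)
    (f g : EuclideanSpace ℝ (Fin N) → ℝ)
    (hf : ContDiff ℝ ∞ f) (hg : ContDiff ℝ ∞ g)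
    (hf_nonneg : ∀ x, 0 ≤ f x) (hg_nonneg : ∀ x, 0 ≤ g x)
    (hf_supp : tsupport f ⊆ Metric.closedBall 0 R) (hg_supp : tsupport g ⊆ Metric.closedBall 0 R)
    (hfg : f ≠ 0 ∨ g ≠ 0) :
    ∃ ε₀ > (0 : ℝ), ∃ C > (0 : ℝ), ∀ ε : ℝ, 0 < ε → ε ≤ ε₀ →
      ∀ (T : EReal) (u : ℝ → L2 N ℝ), 0 < T →
        IsEnergySolution N m p ε f g T u → SupportedInLightCone m R T u →
          ((p : EReal) < pTr N m →
            T ≤ ((C * ε ^ (-(2 * (p - 1) /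
              (2 - ((m + 1) * ((N : ℝ) - 1) - m) * (p - 1)))) : ℝ) : EReal)) ∧
          ((p : EReal) = pTr N m →
            T ≤ ((Real.exp (C * ε ^ (-(p - 1))) : ℝ) : EReal)) := by
  let i₀ : Fin N := ⟨0, hN⟩
  obtain ⟨κ, hκ, hred⟩ := exists_isSupersolution_of_isEnergySolution i₀ hm hp hR
  have hp1 : 0 < p - 1 := by linarith
  have hN1 : (0 : ℝ) ≤ (N : ℝ) - 1 := by
    have : (1 : ℝ) ≤ N := by exact_mod_cast hN
    linarith
  have hβ : 0 ≤ (m + 1) * ((N : ℝ) - 1) * (p - 1) / 2 := by positivity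
  have hU₀ : 0 ≤ ∫ x, f x * Real.exp (x i₀) :=
    integral_nonneg fun x => mul_nonneg (hf_nonneg x) (Real.exp_pos _).le
  have hV₀ : 0 ≤ ∫ x, g x * Real.exp (x i₀) :=
    integral_nonneg fun x => mul_nonneg (hg_nonneg x) (Real.exp_pos _).le
  have h₀ : 0 < (∫ x, f x * Real.exp (x i₀)) + ∫ x, g x * Real.exp (x i₀) := by
    rcases hfg with hne | hne
    · exact add_pos_of_pos_of_nonneg
        (integral_mul_exp_pos i₀ hf.continuous hf_nonneg hf_supp hne) hV₀
    · exact add_pos_of_nonneg_of_pos hU₀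
        (integral_mul_exp_pos i₀ hg.continuous hg_nonneg hg_supp hne)
  set D : ℝ := (m + 1) * ((N : ℝ) - 1) - m with hD
  have hγ : (m + 1) * ((N : ℝ) - 1) * (p - 1) / 2 - m * (p - 1) / 2 = D * (p - 1) / 2 := by
    rw [hD]; ring
  have hsub : (p : EReal) < pTr N m → D * (p - 1) / 2 < 1 := by
    intro h
    unfold pTr at h
    rw [← hD] at h
    split_ifs at h with hD0
    · nlinarith
    · have h1 := EReal.coe_lt_coe_iff.1 h
      rw [← sub_lt_iff_lt_add', lt_div_iff₀ (not_le.1 hD0)] at h1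
      linarith
  have hcrit : (p : EReal) = pTr N m → D * (p - 1) / 2 = 1 := by
    intro h
    unfold pTr at h
    rw [← hD] at h
    split_ifs at h with hD0
    · exact absurd h (EReal.coe_ne_top p)
    · have h1 := EReal.coe_eq_coe_iff.1 h
      rw [h1, add_sub_cancel_left]
      field_simp [(not_le.1 hD0).ne']
  -- `p` is below, equal to or above the critical exponent according to the sign of
  -- `D (p - 1) / 2 - 1`, and both claims are vacuous in the last case
  rcases lt_trichotomy (D * (p - 1) / 2) 1 with hlt | heq | hgt
  · obtain ⟨C, hC, H⟩ := exists_rpow_bound_of_isSupersolution hm hp hβ hκ hU₀ hV₀ h₀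
      (hγ ▸ hlt)
    refine ⟨1, one_pos, C, hC, fun ε hε hε1 T u _ hu hcone => ⟨fun _ => ?_, fun h =>
      absurd (hcrit h) hlt.ne⟩⟩
    have hexp : 2 * (p - 1) / (2 - D * (p - 1)) = (p - 1) / (1 - D * (p - 1) / 2) := by
      rw [div_eq_div_iff (by linarith) (by linarith)]
      ring
    rw [hexp, ← hγ]
    refine EReal.le_coe_of_forall_pos_lt (by positivity) fun S hS hST => ?_
    obtain ⟨U, V, hUV, hU, hV⟩ := hred f g hf_nonneg hg_nonneg hf_supp hg_supp ε hε T u hu hcone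
      S hS hST
    exact H ε hε hε1 S hS U V hUV hU hV
  · obtain ⟨C, hC, H⟩ := exists_exp_bound_of_isSupersolution hm hp hβ hκ hU₀ hV₀ h₀
      (hγ ▸ heq)
    refine ⟨1, one_pos, C, hC, fun ε hε hε1 T u _ hu hcone => ⟨fun h =>
      absurd heq (hsub h).ne, fun _ => ?_⟩⟩
    refine EReal.le_coe_of_forall_pos_lt (by positivity) fun S hS hST => ?_
    obtain ⟨U, V, hUV, hU, hV⟩ := hred f g hf_nonneg hg_nonneg hf_supp hg_supp ε hε T u hu hcone
      S hS hST
    exact H ε hε hε1 S hS U V hUV hU hV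
  · exact ⟨1, one_pos, 1, one_pos, fun ε _ _ T u _ _ _ =>
      ⟨fun h => absurd (hsub h) hgt.not_gt, fun h => absurd (hcrit h) hgt.ne'⟩⟩
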